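/- Let $d\ge 1$ and let $\Omega\subset\mathbb R^d$ be a bounded open set (for instance a bounded Lipschitz domain). Let $\mathcal T_h$ be a finite partition of $\Omega$ into polytopes, not necessarily convex: each element $T\in\mathcal T_h$ is a finite union of $d$-dimensional convex polytopes, the elements have pairwise disjoint interiors contained in $\Omega$, and their union is $\overline\Omega$. Let $\mathcal E_h$ be the finite set of edges/faces of $\mathcal T_h$; these are $(d-1)$-dimensional flat polytopes, any two of which overlap only in a set of $(d-1)$-dimensional measure zero, each is contained in the boundary of some element, and the boundary of each element $T$ is the union of the faces contained in it (the faces of $T$; their number is denoted by $N_T$). On each of its faces, $T$ lies locally on one side, with a constant outward unit normal $\mathbf n$. Let $k\ge q\ge 0$ be integers. Let $V_h$ be the space of weak functions $v=\{v_0,v_b\}$ such that $v_0|_T\in P_k(T)$ for each $T\in\mathcal T_h$ and $v_b|_e\in P_q(e)$ for each $e\in\mathcal E_h$ ($v_b$ is single-valued on a face shared by two elements), and let $V_h^0$ be the subspace of those $v$ with $v_b=0$ on every face contained in $\partial\Omega$. Given degrees $r_T\ge 0$, the discrete weak gradient of $v\in V_h$ on $T$ is the unique $\nabla_w v|_T\in[P_{r_T}(T)]^d$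 such that $$(\nabla_w v,\boldsymbol\varphi)_T=-(v_0,\nabla\cdot\boldsymbol\varphi)_T+\langle v_b,\boldsymbol\varphi\cdot\mathbf n\rangle_{\partial T}\qquad\forall\,\boldsymbol\varphi\in[P_{r_T}(T)]^d .$$ Then there are integers $r_{0,T}\ge 0$ ($T\in\mathcal T_h$), depending only on the mesh, $k$ and $q$, with $$r_{0,T}=2N_T+k-1\quad\text{whenever no hyperplane contains two distinct faces of }T,$$ such that for all degrees $r_T\ge r_{0,T}$ and all $f\in L^2(\Omega)$ there is exactly one $u_h\in V_h^0$ satisfying $$\sum_{T\in\mathcal T_h}(\nabla_w u_h,\nabla_w v)_T=\sum_{T\in\mathcal T_h}(f,v_0)_T\qquad\forall\,v=\{v_0,v_b\}\in V_h^0 .$$ In particular, if no element has two distinct faces in a common hyperplane, the stabilizer-free weak Galerkin scheme with $r_T=2N_T+k-1$ (or with any larger degrees, e.g. $2\max_T N_T+k-1$ for all $T$) has a unique solution; for elements that do have coplanar faces, the same holds with weak-gradient degrees that are large enough. -/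

import Mathlib

open MeasureTheory Topology
open scoped RealInnerProductSpace

namespace WG

/-- `ℝ^d` with its Euclidean structure. -/
abbrev E (d : ℕ) := EuclideanSpace ℝ (Fin d)

/-- The value at a point of `ℝ^d` of a polynomial in the `d` coordinates. -/
noncomputable def pval {d : ℕ} (p : MvPolynomial (Fin d) ℝ) (x : E d) : ℝ :=
  MvPolynomial.eval (fun j => x j) p

/-- Restriction of polynomials to a set `S`, as a linear map into functions on `S`. -/
noncomputable def restrictPoly {d : ℕ} (S : Set (E d)) :
    MvPolynomial (Fin d) ℝ →ₗ[ℝ] (S → ℝ) where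
  toFun p x := pval p x
  map_add' p p' := by ext x; simp [pval]
  map_smul' c p := by ext x; simp [pval]

/-- `P_m(S)`: the functions on `S ⊆ ℝ^d` that are restrictions of polynomials of total degree at
most `m`. -/
noncomputable def P {d : ℕ} (S : Set (E d)) (m : ℕ) : Submodule ℝ (S → ℝ) :=
  (MvPolynomial.restrictTotalDegree (Fin d) ℝ m).map (restrictPoly S)

/-- An `m`-dimensional polytope, not necessarily convex: a nonempty finite union of `m`-dimensional
convex polytopes that lie in one `m`-dimensional affine subspace. -/
def IsPolytope {d : ℕ} (m : ℕ) (S : Set (E d)) : Prop :=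
  S.Nonempty ∧ Module.finrank ℝ (vectorSpan ℝ S) = m ∧
    ∃ C : Finset (Finset (E d)),
      (∀ c ∈ C, affineSpan ℝ (c : Set (E d)) = affineSpan ℝ S) ∧
      S = ⋃ c ∈ C, convexHull ℝ (c : Set (E d))

theorem continuous_pval {d : ℕ} (p : MvPolynomial (Fin d) ℝ) : Continuous (pval p) := by
  unfold pval
  exact (MvPolynomial.continuous_eval p).comp (by fun_prop)

theorem continuous_of_mem_P {d : ℕ} {S : Set (E d)} {m : ℕ} {g : S → ℝ} (hg : g ∈ P S m) :
    Continuous g := by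
  obtain ⟨p, -, rfl⟩ := hg
  exact (continuous_pval p).comp continuous_subtype_val

theorem IsPolytope.isCompact {d m : ℕ} {S : Set (E d)} (h : IsPolytope m S) : IsCompact S := by
  obtain ⟨-, -, C, -, hC⟩ := h
  rw [hC]
  exact C.isCompact_biUnion fun c _ => c.finite_toSet.isCompact_convexHull ℝ

theorem IsPolytope.nonempty_interior {d : ℕ} {S : Set (E d)} (h : IsPolytope d S) :
    (interior S).Nonempty := by
  obtain ⟨hne, hrk, C, hspan, hC⟩ := h
  obtain ⟨x, hx⟩ := hne
  have hx' := hx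
  rw [hC] at hx'
  obtain ⟨c, hc, -⟩ := Set.mem_iUnion₂.1 hx'
  have htop : affineSpan ℝ S = ⊤ := by
    have hv : vectorSpan ℝ S = ⊤ := Submodule.eq_top_of_finrank_eq (by simp [hrk])
    exact (AffineSubspace.affineSpan_eq_top_iff_vectorSpan_eq_top_of_nonempty ℝ _ _ ⟨x, hx⟩).2 hv
  have h1 : (interior (convexHull ℝ (c : Set (E d)))).Nonempty :=
    interior_convexHull_nonempty_iff_affineSpan_eq_top.2 ((hspan c hc).trans htop)
  refine h1.mono (interior_mono ?_)
  intro y hy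
  rw [hC]
  exact Set.mem_iUnion₂.2 ⟨c, hc, hy⟩

/-- An `m`-dimensional polytope has finite `m`-dimensional measure. -/
theorem IsPolytope.measure_lt_top {d m : ℕ} {S : Set (E d)} (h : IsPolytope m S) :
    μHE[m] S < ⊤ := by
  have hc := h.isCompact
  obtain ⟨⟨p, hp⟩, hrk, -⟩ := h
  let f : vectorSpan ℝ S → E d := fun w => (w : E d) + p
  have hf : Isometry f := (IsometryEquiv.addRight p).isometry.comp isometry_subtype_coe
  have hS : S = f '' (f ⁻¹' S) := by
    rw [Set.image_preimage_eq_of_subset]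
    intro x hx
    exact ⟨⟨x - p, vsub_mem_vectorSpan ℝ hx hp⟩, by simp [f]⟩
  rw [hS, hf.euclideanHausdorffMeasure_image]
  have hK : IsCompact (f ⁻¹' S) := hf.isClosedEmbedding.isCompact_preimage hc
  subst hrk
  exact hK.measure_lt_top

theorem integrable_face {d m : ℕ} {S : Set (E d)} (h : IsPolytope m S) {g : S → ℝ}
    (hg : Continuous g) : Integrable g (μHE[m] : Measure S) := by
  have : CompactSpace S := isCompact_iff_compactSpace.1 h.isCompact
  have hfin : IsFiniteMeasure (μHE[m] : Measure S) := by
    constructor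
    have h1 := isometry_subtype_coe.euclideanHausdorffMeasure_image (d := m) (Set.univ : Set S)
    rw [← h1, Set.image_univ, Subtype.range_coe]
    exact h.measure_lt_top
  exact hg.integrable_of_hasCompactSupport (HasCompactSupport.of_compactSpace g)

theorem integrableOn_cell {d : ℕ} {S : Set (E d)} (h : IsPolytope d S)
    (p p' : MvPolynomial (Fin d) ℝ) : IntegrableOn (fun x => pval p x * pval p' x) S :=
  ((continuous_pval p).mul (continuous_pval p')).continuousOn.integrableOn_compact h.isCompact

/-- A polynomial with vanishing `L²` norm on a `d`-dimensional polytope is zero. -/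
theorem eq_zero_of_integral_sq {d : ℕ} {S : Set (E d)} (h : IsPolytope d S)
    (p : MvPolynomial (Fin d) ℝ) (hp : ∫ x in S, pval p x * pval p x = 0) : p = 0 := by
  have hcont : Continuous fun x : E d => pval p x * pval p x :=
    (continuous_pval p).mul (continuous_pval p)
  have hzero : ∀ x ∈ interior S, pval p x = 0 := by
    have hint := integrableOn_cell h p p
    have h0 : (fun x => pval p x * pval p x) =ᵐ[volume.restrict S] 0 :=
      (integral_eq_zero_iff_of_nonneg (fun x => mul_self_nonneg _) hint).1 hp
    have h1 : (fun x => pval p x * pval p x) =ᵐ[volume.restrict (interior S)] 0 :=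
      ae_restrict_of_ae_restrict_of_subset interior_subset h0
    have h2 := Measure.eqOn_open_of_ae_eq h1 isOpen_interior hcont.continuousOn
      continuousOn_const
    intro x hx
    exact mul_self_eq_zero.1 (h2 hx)
  obtain ⟨x₀, hx₀⟩ := h.nonempty_interior
  let L := (EuclideanSpace.equiv (Fin d) ℝ).toHomeomorph
  have hopen : IsOpen (L.symm ⁻¹' interior S) := isOpen_interior.preimage L.symm.continuous
  obtain ⟨ε, hε, hball⟩ := Metric.isOpen_iff.1 hopen (L x₀) (by simpa using hx₀)
  refine MvPolynomial.funext_set (fun j => Set.Ioo (L x₀ j - ε) (L x₀ j + ε))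
    (fun j => Set.Ioo_infinite (by linarith)) ?_
  intro y hy
  have hy' : y ∈ Metric.ball (L x₀) ε := by
    rw [ball_pi _ hε]
    intro j hj
    have := hy j hj
    show y j ∈ Metric.ball (L x₀ j) ε
    rw [Real.ball_eq_Ioo]
    exact this
  have := hzero _ (hball hy')
  simpa [pval, L] using this

/-- `[P_r]^d`: vector fields on `ℝ^d` with polynomial components of total degree at most `r`. On an
element, which has nonempty interior, polynomial functions are identified with polynomials. -/
abbrev PolyField (d r : ℕ) := Fin d → MvPolynomial.restrictTotalDegree (Fin d) ℝ r

/-- The divergence of a polynomial vector field. -/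
noncomputable def divergence {d r : ℕ} (φ : PolyField d r) : MvPolynomial (Fin d) ℝ :=
  ∑ j, MvPolynomial.pderiv j (φ j : MvPolynomial (Fin d) ℝ)

/-- The `L²` inner product `(φ, ψ)_S = ∫_S φ · ψ` of two polynomial vector fields. -/
noncomputable def fieldInner {d r : ℕ} (S : Set (E d)) (φ ψ : PolyField d r) : ℝ :=
  ∑ j, ∫ x in S, pval (φ j : MvPolynomial (Fin d) ℝ) x * pval (ψ j : MvPolynomial (Fin d) ℝ) x

/-- A finite partition of `Ω ⊆ ℝ^d` into polytopes, with its set of edges/faces. The cells are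
closed, may be non-convex, and hanging nodes are allowed: a flat part of the boundary of a cell may
be subdivided into several faces. -/
structure PolytopalMesh (d : ℕ) (Ω : Set (E d)) (ι κ : Type*) where
  /-- The elements `T` of the partition. -/
  cell : ι → Set (E d)
  /-- The edges/faces `e` of the partition. -/
  face : κ → Set (E d)
  cell_polytope : ∀ i, IsPolytope d (cell i)
  face_polytope : ∀ σ, IsPolytope (d - 1) (face σ)
  /-- The elements cover the closure of the domain. -/
  iUnion_cell : ⋃ i, cell i = closure Ω
  interior_cell_subset : ∀ i, interior (cell i) ⊆ Ω
  /-- Distinct elements do not overlap. -/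
  cell_disjoint : ∀ i j, i ≠ j → Disjoint (interior (cell i)) (interior (cell j))
  /-- Every face is a face of some element. -/
  face_subset : ∀ σ, ∃ i, face σ ⊆ frontier (cell i)
  /-- The boundary of each element is the union of the faces contained in it. -/
  frontier_cell : ∀ i, frontier (cell i) = ⋃ σ ∈ {σ | face σ ⊆ frontier (cell i)}, face σ
  /-- Distinct faces do not overlap: they meet in a set of vanishing `(d-1)`-dimensional measure. -/
  face_disjoint : ∀ σ τ, σ ≠ τ → μHE[d - 1] (face σ ∩ face τ) = 0
  /-- `normal i σ` is the outward unit normal to the `i`-th element on its face `σ` (it is not used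
  if `σ` is not a face of that element). -/
  normal : ι → κ → E d
  norm_normal : ∀ i σ, face σ ⊆ frontier (cell i) → ‖normal i σ‖ = 1
  /-- Near almost every point of its face `σ`, the element is the half-space on the side of the
  face opposite to the outward normal. -/
  normal_outward : ∀ i σ, face σ ⊆ frontier (cell i) →
    ∀ᵐ x : face σ ∂μHE[d - 1], ∀ᶠ y in 𝓝 (x : E d), y ∈ cell i ↔ ⟪normal i σ, y - x⟫ ≤ 0

namespace PolytopalMesh

/-- The (indices of the) faces of the `i`-th element. -/
noncomputable def faces {d : ℕ} {Ω : Set (E d)} {ι κ : Type*} [Fintype κ]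
    (M : PolytopalMesh d Ω ι κ) (i : ι) : Finset κ :=
  open Classical in Finset.univ.filter fun σ => M.face σ ⊆ frontier (M.cell i)

/-- No hyperplane contains two distinct faces of the `i`-th element. -/
def FacesInDistinctHyperplanes {d : ℕ} {Ω : Set (E d)} {ι κ : Type*} [Fintype κ]
    (M : PolytopalMesh d Ω ι κ) (i : ι) : Prop :=
  ∀ σ ∈ M.faces i, ∀ τ ∈ M.faces i, σ ≠ τ →
    affineSpan ℝ (M.face σ) ≠ affineSpan ℝ (M.face τ)

/-- The weak finite element space `V_h`: a weak function `v = {v₀, v_b}` consists of a polynomial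
`v₀` of degree at most `k` on each element and a polynomial `v_b` of degree at most `q` on each
face, the latter being common to the elements that share the face. -/
abbrev Vh {d : ℕ} {Ω : Set (E d)} {ι κ : Type*} (M : PolytopalMesh d Ω ι κ) (k q : ℕ) :=
  (ι → MvPolynomial.restrictTotalDegree (Fin d) ℝ k) × (∀ σ, P (M.face σ) q)

/-- The subspace `V_h^0` of weak functions with `v_b = 0` on `∂Ω`, that is, on the faces contained
in `∂Ω`. -/
def Vh0 {d : ℕ} {Ω : Set (E d)} {ι κ : Type*} (M : PolytopalMesh d Ω ι κ) (k q : ℕ) :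
    Submodule ℝ (M.Vh k q) where
  carrier := {v | ∀ σ, M.face σ ⊆ frontier Ω → v.2 σ = 0}
  add_mem' := by
    intro a b ha hb σ hσ
    simp [ha σ hσ, hb σ hσ]
  zero_mem' := by
    intro σ _
    rfl
  smul_mem' := by
    intro c a ha σ hσ
    simp [ha σ hσ]

/-- The functional `φ ↦ -(v₀, ∇·φ)_T + ⟨v_b, φ·n⟩_{∂T}` on `[P_r]^d`, where `T` is the `i`-th
element and `n` its outward unit normal. -/
noncomputable def weakFunctional {d : ℕ} {Ω : Set (E d)} {ι κ : Type*} [Fintype κ]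
    (M : PolytopalMesh d Ω ι κ) {k q r : ℕ} (v : M.Vh k q) (i : ι) (φ : PolyField d r) : ℝ :=
  -(∫ x in M.cell i, pval (v.1 i : MvPolynomial (Fin d) ℝ) x * pval (divergence φ) x)
    + ∑ σ ∈ M.faces i, ∫ x : M.face σ,
        (v.2 σ : M.face σ → ℝ) x *
          ∑ j, pval (φ j : MvPolynomial (Fin d) ℝ) (x : E d) * M.normal i σ j ∂μHE[d - 1]

/-- Existence and uniqueness of the discrete weak gradient of given degree on an element. -/
theorem existsUnique_weakGrad {d : ℕ} {Ω : Set (E d)} {ι κ : Type*} [Fintype κ]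
    (M : PolytopalMesh d Ω ι κ) {k q : ℕ} (r : ℕ) (v : M.Vh k q) (i : ι) :
    ∃! g : PolyField d r, ∀ φ : PolyField d r,
      fieldInner (M.cell i) g φ = M.weakFunctional v i φ := by
  have hT := M.cell_polytope i
  have pv_add : ∀ (a b : MvPolynomial (Fin d) ℝ) (x : E d),
      pval (a + b) x = pval a x + pval b x := fun a b x => by simp [pval]
  have pv_smul : ∀ (c : ℝ) (a : MvPolynomial (Fin d) ℝ) (x : E d),
      pval (c • a) x = c * pval a x := fun c a x => by simp [pval]
  have hcont : ∀ {S : Set (E d)} (a : MvPolynomial (Fin d) ℝ),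
      Continuous fun x : S => pval a x :=
    fun a => (continuous_pval a).comp continuous_subtype_val
  have hint : ∀ a b : MvPolynomial (Fin d) ℝ,
      Integrable (fun x => pval a x * pval b x) (volume.restrict (M.cell i)) :=
    integrableOn_cell hT
  have hintb : ∀ (σ : κ) (φ : PolyField d r),
      Integrable (fun x : M.face σ => (v.2 σ : M.face σ → ℝ) x *
        ∑ j, pval (φ j : MvPolynomial (Fin d) ℝ) (x : E d) * M.normal i σ j) μHE[d - 1] := fun σ φ =>
    integrable_face (M.face_polytope σ) ((continuous_of_mem_P (v.2 σ).2).mul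
      (continuous_finsetSum _ fun j _ => (hcont _).mul continuous_const))
  let B : PolyField d r →ₗ[ℝ] PolyField d r →ₗ[ℝ] ℝ := LinearMap.mk₂ ℝ (fieldInner (M.cell i))
    (by
      intro a b c
      simp only [fieldInner, Pi.add_apply, Submodule.coe_add, pv_add, add_mul,
        integral_add (hint _ _) (hint _ _), Finset.sum_add_distrib])
    (by
      intro c a b
      simp only [fieldInner, Pi.smul_apply, Submodule.coe_smul, pv_smul, mul_assoc,
        integral_const_mul, Finset.mul_sum, smul_eq_mul])
    (by
      intro a b c
      simp only [fieldInner, Pi.add_apply, Submodule.coe_add, pv_add, mul_add,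
        integral_add (hint _ _) (hint _ _), Finset.sum_add_distrib])
    (by
      intro c a b
      simp only [fieldInner, Pi.smul_apply, Submodule.coe_smul, pv_smul, mul_left_comm,
        integral_const_mul, Finset.mul_sum, smul_eq_mul])
  have hinj : Function.Injective B := by
    rw [← LinearMap.ker_eq_bot, LinearMap.ker_eq_bot']
    intro g hg
    have h0 : fieldInner (M.cell i) g g = 0 := by
      exact LinearMap.congr_fun hg g
    have h1 := (Finset.sum_eq_zero_iff_of_nonneg (fun j _ =>
      integral_nonneg fun x => mul_self_nonneg (pval (g j : MvPolynomial (Fin d) ℝ) x))).1 h0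
    funext j
    exact Subtype.ext (eq_zero_of_integral_sq hT _ (h1 j (Finset.mem_univ j)))
  have hsurj : Function.Surjective B :=
    (LinearMap.injective_iff_surjective_of_finrank_eq_finrank
      (Subspace.dual_finrank_eq (K := ℝ) (V := PolyField d r)).symm).1 hinj
  let F : PolyField d r →ₗ[ℝ] ℝ :=
    { toFun := M.weakFunctional v i
      map_add' := by
        intro a b
        have hd : divergence (a + b) = divergence a + divergence b := by
          simp [divergence, Finset.sum_add_distrib]
        have hb : ∀ σ, ∫ x : M.face σ, (v.2 σ : M.face σ → ℝ) x *
            ∑ j, pval ((a + b) j : MvPolynomial (Fin d) ℝ) (x : E d) * M.normal i σ j ∂μHE[d - 1] =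
            (∫ x : M.face σ, (v.2 σ : M.face σ → ℝ) x *
              ∑ j, pval (a j : MvPolynomial (Fin d) ℝ) (x : E d) * M.normal i σ j ∂μHE[d - 1]) +
            ∫ x : M.face σ, (v.2 σ : M.face σ → ℝ) x *
              ∑ j, pval (b j : MvPolynomial (Fin d) ℝ) (x : E d) * M.normal i σ j ∂μHE[d - 1] := by
          intro σ
          rw [← integral_add (hintb σ a) (hintb σ b)]
          simp only [Pi.add_apply, Submodule.coe_add, pv_add, add_mul, Finset.sum_add_distrib,
            mul_add]
        simp only [weakFunctional, hd, pv_add, mul_add, hb, Finset.sum_add_distrib,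
          integral_add (hint _ _) (hint _ _)]
        ring
      map_smul' := by
        intro c a
        have hd : divergence (c • a) = c • divergence a := by
          simp [divergence, Finset.smul_sum]
        have hb : ∀ σ, ∫ x : M.face σ, (v.2 σ : M.face σ → ℝ) x *
            ∑ j, pval ((c • a) j : MvPolynomial (Fin d) ℝ) (x : E d) * M.normal i σ j ∂μHE[d - 1] =
            c * ∫ x : M.face σ, (v.2 σ : M.face σ → ℝ) x *
              ∑ j, pval (a j : MvPolynomial (Fin d) ℝ) (x : E d) * M.normal i σ j ∂μHE[d - 1] := by
          intro σ
          rw [← integral_const_mul]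
          simp only [Pi.smul_apply, Submodule.coe_smul, pv_smul, mul_assoc, ← Finset.mul_sum]
          simp only [mul_left_comm]
        simp only [weakFunctional, hd, pv_smul, mul_left_comm _ c, hb, ← Finset.mul_sum,
          integral_const_mul, RingHom.id_apply, smul_eq_mul]
        ring }
  obtain ⟨g, hg⟩ := hsurj F
  have hgF : ∀ φ, fieldInner (M.cell i) g φ = M.weakFunctional v i φ :=
    fun φ => LinearMap.congr_fun hg φ
  refine ⟨g, hgF, fun g' hg' => hinj (LinearMap.ext fun φ => ?_)⟩
  have h1 : B g' φ = fieldInner (M.cell i) g' φ := rfl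
  have h2 : B g φ = fieldInner (M.cell i) g φ := rfl
  rw [h1, h2, hg' φ, hgF φ]

/-- The discrete weak gradient `∇_{w,r,T} v` on the `i`-th element `T`: the unique `g ∈ [P_r(T)]^d`
with `(g, φ)_T = -(v₀, ∇·φ)_T + ⟨v_b, φ·n⟩_{∂T}` for all `φ ∈ [P_r(T)]^d`. -/
noncomputable def weakGrad {d : ℕ} {Ω : Set (E d)} {ι κ : Type*} [Fintype κ]
    (M : PolytopalMesh d Ω ι κ) {k q : ℕ} (r : ℕ) (v : M.Vh k q) (i : ι) : PolyField d r :=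
  (M.existsUnique_weakGrad r v i).choose

theorem weakGrad_spec {d : ℕ} {Ω : Set (E d)} {ι κ : Type*} [Fintype κ]
    (M : PolytopalMesh d Ω ι κ) {k q : ℕ} (r : ℕ) (v : M.Vh k q) (i : ι) (φ : PolyField d r) :
    fieldInner (M.cell i) (M.weakGrad r v i) φ = M.weakFunctional v i φ :=
  (M.existsUnique_weakGrad r v i).choose_spec.1 φ

/-- `u ∈ V_h^0` solves the weak Galerkin scheme with load `f`, the discrete weak gradient being of
degree `r i` on the `i`-th element: `∑_T (∇_w u, ∇_w v)_T = ∑_T (f, v₀)_T` for all `v ∈ V_h^0`. -/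
def IsWGSolution {d : ℕ} {Ω : Set (E d)} {ι κ : Type*} [Fintype ι] [Fintype κ]
    (M : PolytopalMesh d Ω ι κ) {k q : ℕ} (r : ι → ℕ) (f : E d → ℝ) (u : M.Vh k q) : Prop :=
  u ∈ M.Vh0 k q ∧ ∀ v ∈ M.Vh0 k q,
    ∑ i, fieldInner (M.cell i) (M.weakGrad (r i) u i) (M.weakGrad (r i) v i) =
      ∑ i, ∫ x in M.cell i, f x * pval (v.1 i : MvPolynomial (Fin d) ℝ) x

end PolytopalMesh

end WG

/-! The scheme is a square linear system on the finite-dimensional space `Vh0`, so it suffices that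
its symmetric form is definite: if all weak gradients of `v` vanish, then `v = 0`. This has a local
half and a global half.

Local half. Let `B` be the product of the affine functions of all faces of `T`. Testing with `B²
∇v₀`, which vanishes on `∂T`, and integrating by parts gives `∫ B² |∇v₀|² = 0`, so `v₀` is a
constant `c` (`exists_eq_C`). For a face `σ` with normal `n`, let `B` instead omit the faces in the
hyperplane of `σ`. A test field `g n` with `B² ∣ g` then sees only the faces in that hyperplane
(`weakFunctional_normal`). If `σ` is the only one, `g = (v_b - c) B²` gives `∫_σ (v_b - c)² B² = 0`,
within degree `2N + k - 1` (`isConstOn_of_distinct`). Otherwise all `g = p B²` are used, and density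
of polynomials gives `v_b = c` on each coplanar face (`isConstOn_of_forall`). The kernels of the
weak gradient decrease with the degree, so they stabilize and one finite degree suffices
(`exists_degree_isConstOn`).

The divergence theorem is needed only for fields in a fixed direction that vanish to second order
off one hyperplane. There it reduces to Fubini and the fundamental theorem of calculus on lines, the
only contribution being the jump at the hyperplane (`setIntegral_deriv_eq_integral_jump`).

Global half. The constants agree across shared faces and vanish on boundary faces. A generic line
from any element leaves the bounded domain and crosses faces only at generic points, so the constant
of that element is zero (`eq_zero_of_isConstOn`). -/

namespace WG

open Filter Set

/-! ### Derivatives along lines and the jump across a hyperplane -/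

/-- The indicator of a set times a function that vanishes to second order at the boundary points of
the set is differentiable. -/
theorem hasDerivAt_indicator {A : Set ℝ} {h : ℝ → ℝ} {h' t : ℝ} (hd : HasDerivAt h h' t)
    (hfr : t ∈ frontier A → h t = 0 ∧ h' = 0) :
    HasDerivAt (A.indicator h) (A.indicator (fun _ => h') t) t := by
  by_cases hint : t ∈ interior A
  · rw [indicator_of_mem (interior_subset hint)]
    refine hd.congr_of_eventuallyEq ?_
    filter_upwards [isOpen_interior.mem_nhds hint] with s hs
    exact indicator_of_mem (interior_subset hs) h
  by_cases hcl : t ∈ closure A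
  · obtain ⟨h0, h1⟩ := hfr ⟨hcl, hint⟩
    subst h1
    rw [indicator_zero, hasDerivAt_iff_isLittleO]
    rw [hasDerivAt_iff_isLittleO] at hd
    have hF : A.indicator h t = 0 := by
      by_cases ht : t ∈ A <;> simp [ht, h0]
    -- At a frontier point the indicator only decreases `|h|`, and `h` is already `o(s - t)` there.
    refine Asymptotics.IsLittleO.of_norm_left ?_
    refine (Asymptotics.IsBigO.of_bound 1 (Eventually.of_forall fun s => ?_)).trans_isLittleO hd
    rw [hF, h0]
    by_cases hs : s ∈ A <;> simp [hs]
  · rw [indicator_of_notMem fun ht => hcl (subset_closure ht)]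
    refine (hasDerivAt_const t (0 : ℝ)).congr_of_eventuallyEq ?_
    filter_upwards [isClosed_closure.isOpen_compl.mem_nhds hcl] with s hs
    exact indicator_of_notMem (fun h' => hs (subset_closure h')) h

/-- The integral over a compact subset of the line of the derivative of a function that vanishes to
second order at the boundary points other than `0`. -/
theorem setIntegral_deriv_eq_jump {A : Set ℝ} (hA : IsCompact A) {h h' : ℝ → ℝ}
    (hd : ∀ t, HasDerivAt h (h' t) t) (hc : Continuous h')
    (hfr : ∀ t ∈ frontier A, t ≠ 0 → h t = 0 ∧ h' t = 0) {L R : ℝ}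
    (hL : Tendsto (A.indicator h) (𝓝[<] 0) (𝓝 L)) (hR : Tendsto (A.indicator h) (𝓝[>] 0) (𝓝 R)) :
    ∫ t in A, h' t = L - R := by
  have hder : ∀ t, t ≠ 0 → HasDerivAt (A.indicator h) (A.indicator h' t) t := by
    intro t ht
    have := hasDerivAt_indicator (A := A) (hd t) fun hf => hfr t hf ht
    simpa [indicator] using this
  obtain ⟨b, hb⟩ := hA.isBounded.subset_ball 0
  -- The endpoints `±r` lie outside `A`, so the indicator function vanishes there and only the
  -- limits at `0` survive in the two applications of the fundamental theorem.
  set r := max b 0 + 1 with hr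
  have hr0 : 0 < r := by positivity
  have hAr : A ⊆ Ioo (-r) r := by
    intro t ht
    have := hb ht
    rw [Real.ball_eq_Ioo] at this
    have h1 : b < r := by rw [hr]; linarith [le_max_left b 0]
    exact ⟨by linarith [this.1], by linarith [this.2]⟩
  have hint : Integrable (A.indicator h') :=
    (hc.continuousOn.integrableOn_compact hA).integrable_indicator hA.measurableSet
  have hout : ∀ t, t ∉ Ioo (-r) r → A.indicator h t = 0 := fun t ht =>
    indicator_of_notMem (fun h1 => ht (hAr h1)) _
  have h1 : ∫ t in (-r)..0, A.indicator h' t = L - 0 := by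
    refine intervalIntegral.integral_eq_sub_of_hasDerivAt_of_tendsto (by linarith)
      (fun t ht => hder t ht.2.ne) hint.intervalIntegrable ?_ hL
    have := (hder (-r) (by linarith)).continuousAt.tendsto
    rw [hout (-r) (by simp)] at this
    exact this.mono_left nhdsWithin_le_nhds
  have h2 : ∫ t in (0)..r, A.indicator h' t = 0 - R := by
    refine intervalIntegral.integral_eq_sub_of_hasDerivAt_of_tendsto (by linarith)
      (fun t ht => hder t ht.1.ne') hint.intervalIntegrable hR ?_
    have := (hder r (by linarith)).continuousAt.tendsto
    rw [hout r (by simp)] at this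
    exact this.mono_left nhdsWithin_le_nhds
  have h3 : ∫ t in (-r)..r, A.indicator h' t = ∫ t in A, h' t := by
    rw [intervalIntegral.integral_of_le (by linarith), setIntegral_indicator hA.measurableSet,
      inter_eq_self_of_subset_right (hAr.trans Ioo_subset_Ioc_self)]
  rw [← h3, ← intervalIntegral.integral_add_adjacent_intervals (b := 0)
    hint.intervalIntegrable hint.intervalIntegrable, h1, h2]
  ring

/-- Fubini's theorem along the lines in the direction of a unit vector. -/
theorem integral_eq_integral_lines {d : ℕ} {n : E d} (hn : ‖n‖ = 1) (x₀ : E d) {u : E d → ℝ}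
    (hu : Integrable u) :
    ∫ x, u x = ∫ w : (ℝ ∙ n)ᗮ, ∫ t : ℝ, u (t • n + w + x₀) := by
  have hmp := (ℝ ∙ n).measurePreserving_measurableEquivProd x₀
  rw [InnerProductSpace.euclideanHausdorffMeasure_eq_volume] at hmp
  have h1 := hmp.symm.integral_comp' (g := u)
  have hint := (hmp.symm.integrable_comp_emb (MeasurableEquiv.measurableEmbedding _)).2 hu
  rw [← h1, Measure.volume_eq_prod]
  rw [Measure.volume_eq_prod] at hint
  refine (integral_prod_symm _ hint).trans ?_
  refine integral_congr_ae (Eventually.of_forall fun w => ?_)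
  have h2 := (LinearIsometryEquiv.toSpanUnitSingleton (𝕜 := ℝ) n hn).measurePreserving
  have h3 := h2.integral_comp
    (LinearIsometryEquiv.toSpanUnitSingleton (𝕜 := ℝ) n hn).toHomeomorph.measurableEmbedding
    (fun s : ℝ ∙ n => u ((s : E d) + w + x₀))
  simpa using h3.symm

theorem finrank_orthogonal_unit {d : ℕ} {n : E d} (hn : ‖n‖ = 1) :
    Module.finrank ℝ (ℝ ∙ n)ᗮ = d - 1 := by
  have hn0 : n ≠ 0 := fun h => by simp [h] at hn
  have h1 := (ℝ ∙ n).finrank_add_finrank_orthogonal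
  rw [finrank_span_singleton hn0] at h1
  simp at h1
  omega

theorem volume_orthogonal_unit {d : ℕ} {n : E d} (hn : ‖n‖ = 1) :
    (μHE[d - 1] : Measure (ℝ ∙ n)ᗮ) = volume := by
  rw [← finrank_orthogonal_unit hn, InnerProductSpace.euclideanHausdorffMeasure_eq_volume]

theorem isometry_add_orthogonal {d : ℕ} (n x₀ : E d) :
    Isometry fun w : (ℝ ∙ n)ᗮ => (w : E d) + x₀ :=
  (IsometryEquiv.addRight x₀).isometry.comp isometry_subtype_coe

theorem mem_range_add_orthogonal {d : ℕ} {n x₀ x : E d} :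
    x ∈ range (fun w : (ℝ ∙ n)ᗮ => (w : E d) + x₀) ↔ ⟪n, x - x₀⟫ = 0 := by
  constructor
  · rintro ⟨w, rfl⟩
    simpa using Submodule.mem_orthogonal_singleton_iff_inner_right.1 w.2
  · intro h
    exact ⟨⟨x - x₀, Submodule.mem_orthogonal_singleton_iff_inner_right.2 h⟩, by simp⟩

/-- Sets in a hyperplane are measured by the volume of the hyperplane. -/
theorem map_volume_orthogonal {d : ℕ} {n : E d} (hn : ‖n‖ = 1) (x₀ : E d) :
    (volume : Measure (ℝ ∙ n)ᗮ).map (fun w : (ℝ ∙ n)ᗮ => (w : E d) + x₀) =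
      (μHE[d - 1] : Measure (E d)).restrict {x | ⟪n, x - x₀⟫ = 0} := by
  have h := (isometry_add_orthogonal n x₀).map_euclideanHausdorffMeasure (d := d - 1)
  rw [volume_orthogonal_unit hn] at h
  rw [h]
  congr 1
  ext x
  exact mem_range_add_orthogonal

/-- The integral over a closed part of a hyperplane. -/
theorem setIntegral_hyperplane {d : ℕ} {n : E d} (hn : ‖n‖ = 1) (x₀ : E d) {S : Set (E d)}
    (hS : IsClosed S) (hSn : ∀ x ∈ S, ⟪n, x - x₀⟫ = 0) (u : E d → ℝ) :
    ∫ x in S, u x ∂μHE[d - 1] = ∫ w : (ℝ ∙ n)ᗮ, S.indicator u (w + x₀) := by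
  have he := (isometry_add_orthogonal n x₀).isClosedEmbedding.measurableEmbedding
  rw [← he.integral_map (μ := volume) (S.indicator u), map_volume_orthogonal hn,
    setIntegral_indicator hS.measurableSet, inter_eq_self_of_subset_right]
  exact hSn

/-- Integrals over a closed set regarded as a metric space. -/
theorem integral_subtype_hausdorff {d m : ℕ} {S : Set (E d)} (hS : IsClosed S) (u : E d → ℝ) :
    ∫ x : S, u x ∂μHE[m] = ∫ x in S, u x ∂μHE[m] := by
  have h := (isometry_subtype_coe (s := S)).map_euclideanHausdorffMeasure (d := m)
  rw [Subtype.range_coe] at h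
  rw [← h, (MeasurableEmbedding.subtype_coe hS.measurableSet).integral_map]

theorem ae_subtype_hausdorff {d m : ℕ} {S : Set (E d)} (hS : IsClosed S) {p : E d → Prop} :
    (∀ᵐ x : S ∂μHE[m], p x) ↔ ∀ᵐ x ∂(μHE[m] : Measure (E d)).restrict S, p x := by
  have h := (isometry_subtype_coe (s := S)).map_euclideanHausdorffMeasure (d := m)
  rw [Subtype.range_coe] at h
  rw [← h, (MeasurableEmbedding.subtype_coe hS.measurableSet).ae_map_iff]

/-- The integral of a directional derivative over a compact set, for a function that vanishes to
second order at the boundary points outside a hyperplane orthogonal to the direction, is the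
integral over the hyperplane of the jump. -/
theorem setIntegral_deriv_eq_integral_jump {d : ℕ} {T : Set (E d)} (hT : IsCompact T) {n : E d}
    (hn : ‖n‖ = 1) (x₀ : E d) {g g' : E d → ℝ} (hg' : Continuous g')
    (hd : ∀ (y : E d) (t : ℝ), HasDerivAt (fun t : ℝ => g (t • n + y)) (g' (t • n + y)) t)
    (hfr : ∀ x ∈ frontier T, ⟪n, x - x₀⟫ ≠ 0 → g x = 0 ∧ g' x = 0) {J : (ℝ ∙ n)ᗮ → ℝ}
    (hJ : ∀ᵐ w : (ℝ ∙ n)ᗮ, ∃ L R,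
      Tendsto (fun t : ℝ => T.indicator g (t • n + (w + x₀))) (𝓝[<] 0) (𝓝 L) ∧
      Tendsto (fun t : ℝ => T.indicator g (t • n + (w + x₀))) (𝓝[>] 0) (𝓝 R) ∧ L - R = J w) :
    ∫ x in T, g' x = ∫ w, J w := by
  have hint : Integrable (T.indicator g') :=
    (hg'.continuousOn.integrableOn_compact hT).integrable_indicator hT.measurableSet
  rw [← integral_indicator hT.measurableSet, integral_eq_integral_lines hn x₀ hint]
  refine integral_congr_ae ?_
  filter_upwards [hJ] with w ⟨L, R, hL, hR, hw⟩
  have hγc : Continuous fun t : ℝ => t • n + (w + x₀) := by fun_prop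
  have hγ : Isometry fun t : ℝ => t • n + (w + x₀) := by
    refine Isometry.of_dist_eq fun s t => ?_
    rw [dist_add_right, dist_eq_norm, ← sub_smul, norm_smul, hn, mul_one, dist_eq_norm]
  rw [← hw, ← setIntegral_deriv_eq_jump (hγ.isClosedEmbedding.isCompact_preimage hT)
    (hd (w + x₀)) (hg'.comp hγc) ?_ hL hR,
    ← integral_indicator (hT.isClosed.preimage hγc).measurableSet]
  · simp only [add_assoc]
    rfl
  · intro t ht ht0
    refine hfr _ (hγc.frontier_preimage_subset T ht) ?_
    -- The height of the point over the hyperplane is exactly `t`, so the exceptional parameter on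
    -- every line is `0`.
    have h0 : ⟪n, (w : E d)⟫ = 0 := Submodule.mem_orthogonal_singleton_iff_inner_right.1 w.2
    have : t • n + (w + x₀) - x₀ = t • n + w := by abel
    simpa [this, inner_add_right, inner_smul_right, h0, hn] using ht0

theorem hasDerivAt_pval {d : ℕ} (p : MvPolynomial (Fin d) ℝ) (n y : E d) (t : ℝ) :
    HasDerivAt (fun t : ℝ => pval p (t • n + y))
      (∑ j, n j * pval (MvPolynomial.pderiv j p) (t • n + y)) t := by
  induction p using MvPolynomial.induction_on with
  | C a => simpa [pval] using hasDerivAt_const t a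
  | add p q hp hq =>
    have := hp.add hq
    simp only [pval, map_add, mul_add, Finset.sum_add_distrib] at this ⊢
    exact this
  | mul_X p i hp =>
    have hX : HasDerivAt (fun t : ℝ => (t • n + y) i) (n i) t := by
      simpa using ((hasDerivAt_id t).mul_const (n i)).add_const (y i)
    have := hp.fun_mul hX
    simp only [pval, Derivation.leibniz, MvPolynomial.pderiv_X, smul_eq_mul, map_add, map_mul,
      MvPolynomial.eval_X, mul_add, Finset.sum_add_distrib] at this ⊢
    refine this.congr_deriv ?_
    rw [add_comm, Finset.sum_mul]
    congr 1
    · rw [Finset.sum_eq_single i]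
      · simp [mul_comm]
      · intro j _ hj
        simp [hj.symm]
      · simp
    · exact Finset.sum_congr rfl fun j _ => by ring

/-! ### Measure and direction of polytopes and their faces -/

/-- Every relatively open nonempty part of a polytope has positive measure. -/
theorem IsPolytope.measure_inter_ne_zero {d m : ℕ} {S : Set (E d)} (h : IsPolytope m S) {x : E d}
    (hx : x ∈ S) {U : Set (E d)} (hU : U ∈ 𝓝 x) : μHE[m] (S ∩ U) ≠ 0 := by
  obtain ⟨-, hrk, C, hspan, hC⟩ := h
  have hx' := hx
  rw [hC] at hx'
  obtain ⟨c, hc, hxc⟩ := mem_iUnion₂.1 hx'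
  set V := vectorSpan ℝ S with hV
  -- `f` identifies the direction space with the affine span, isometrically and with origin at `x`.
  -- The convex piece through `x` becomes a full-dimensional convex set, hence lies in the closure
  -- of its interior, so `U` meets that interior.
  let f : V →ᵃ[ℝ] E d := (AffineEquiv.vaddConst ℝ x).toAffineMap.comp V.subtype.toAffineMap
  have hfapp : ∀ w : V, f w = w + x := fun w => rfl
  have hf : Isometry f := (IsometryEquiv.addRight x).isometry.comp isometry_subtype_coe
  have hcS : (c : Set (E d)) ⊆ S := by
    intro y hy
    rw [hC]
    exact mem_iUnion₂.2 ⟨c, hc, subset_convexHull ℝ _ hy⟩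
  have hcf : f '' (f ⁻¹' c) = c := by
    rw [image_preimage_eq_of_subset]
    intro y hy
    exact ⟨⟨y - x, vsub_mem_vectorSpan ℝ (hcS hy) hx⟩, by simp [hfapp]⟩
  have htop : affineSpan ℝ (f ⁻¹' (c : Set (E d))) = ⊤ := by
    have h1 : (affineSpan ℝ (f ⁻¹' (c : Set (E d)))).map f = affineSpan ℝ S := by
      rw [AffineSubspace.map_span, hcf, hspan c hc]
    rw [eq_top_iff]
    intro w _
    have h2 : f w ∈ (affineSpan ℝ (f ⁻¹' (c : Set (E d)))).map f := by
      rw [h1, hfapp]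
      refine (AffineSubspace.vadd_mem_iff_mem_direction _ (subset_affineSpan ℝ S hx)).2 ?_
      rw [direction_affineSpan]
      exact w.2
    obtain ⟨w', hw', he⟩ := (AffineSubspace.mem_map).1 h2
    rwa [← hf.injective he]
  have hint := interior_convexHull_nonempty_iff_affineSpan_eq_top.2 htop
  have hcl := (convex_convexHull ℝ (f ⁻¹' (c : Set (E d)))).closure_interior_eq_closure_of_nonempty_interior hint
  have himg : f '' convexHull ℝ (f ⁻¹' (c : Set (E d))) = convexHull ℝ (c : Set (E d)) := by
    rw [f.image_convexHull, hcf]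
  have h0 : (0 : V) ∈ closure (interior (convexHull ℝ (f ⁻¹' (c : Set (E d))))) := by
    rw [hcl]
    refine subset_closure ?_
    rw [← himg] at hxc
    obtain ⟨w, hw, hwx⟩ := hxc
    have : w = 0 := hf.injective (by rw [hwx, hfapp]; simp)
    rwa [← this]
  have hU' : f ⁻¹' interior U ∈ 𝓝 (0 : V) := by
    refine hf.continuous.continuousAt.preimage_mem_nhds ?_
    rw [hfapp]
    simpa using hU
  obtain ⟨w, hwU, hwi⟩ := mem_closure_iff_nhds.1 h0 _ hU'
  have hopen : IsOpen (f ⁻¹' interior U ∩ interior (convexHull ℝ (f ⁻¹' (c : Set (E d))))) :=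
    (isOpen_interior.preimage hf.continuous).inter isOpen_interior
  have hpos := (hopen.measure_pos volume ⟨w, hwU, hwi⟩).ne'
  rw [← InnerProductSpace.euclideanHausdorffMeasure_eq_volume, hrk,
    ← hf.euclideanHausdorffMeasure_image] at hpos
  refine fun hz => hpos (measure_mono_null ?_ hz)
  rintro _ ⟨w, ⟨hw1, hw2⟩, rfl⟩
  refine ⟨?_, interior_subset hw1⟩
  rw [hC]
  exact mem_iUnion₂.2 ⟨c, hc, himg ▸ mem_image_of_mem f (interior_subset hw2)⟩

/-- A vector that is orthogonal to a polytope near one of its points is orthogonal to all of it. -/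
theorem IsPolytope.inner_eq_zero_of_eventually {d m : ℕ} {S : Set (E d)} (h : IsPolytope m S)
    {x n : E d} (hx : x ∈ S) (hn : ∀ᶠ y in 𝓝 x, y ∈ S → ⟪n, y - x⟫ = 0) {v : E d}
    (hv : v ∈ vectorSpan ℝ S) : ⟪n, v⟫ = 0 := by
  obtain ⟨-, hrk, C, hspan, hC⟩ := h
  have hx' := hx
  rw [hC] at hx'
  obtain ⟨c, hc, hxc⟩ := mem_iUnion₂.1 hx'
  have hcS : convexHull ℝ (c : Set (E d)) ⊆ S := by
    intro y hy
    rw [hC]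
    exact mem_iUnion₂.2 ⟨c, hc, hy⟩
  -- The segment from `x` to a vertex of its convex piece stays in `S`. Near `x` the hypothesis
  -- applies to it, and linearity extends the equality to the vertex.
  have key : ∀ y ∈ (c : Set (E d)), ⟪n, y - x⟫ = 0 := by
    intro y hy
    have hcont : Continuous fun t : ℝ => x + t • (y - x) := by fun_prop
    have h1 : ∀ᶠ t in 𝓝 (0 : ℝ), x + t • (y - x) ∈ S → ⟪n, x + t • (y - x) - x⟫ = 0 := by
      have h0 : Tendsto (fun t : ℝ => x + t • (y - x)) (𝓝 0) (𝓝 x) := by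
        simpa using hcont.tendsto 0
      exact h0.eventually hn
    have h2 : ∀ᶠ t in 𝓝[>] (0 : ℝ), x + t • (y - x) ∈ S → ⟪n, x + t • (y - x) - x⟫ = 0 :=
      h1.filter_mono nhdsWithin_le_nhds
    obtain ⟨t, ht1, ht0, ht⟩ := (h2.and (Ioo_mem_nhdsGT (zero_lt_one' ℝ))).exists
    have hmem : x + t • (y - x) ∈ S :=
      hcS ((convex_convexHull ℝ _).add_smul_sub_mem hxc (subset_convexHull ℝ _ hy) ⟨ht0.le, ht.le⟩)
    have h3 := ht1 hmem
    rw [add_sub_cancel_left, inner_smul_right] at h3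
    exact (mul_eq_zero.1 h3).resolve_left ht0.ne'
  have hvc : v ∈ vectorSpan ℝ (c : Set (E d)) := by
    rw [← direction_affineSpan, hspan c hc, direction_affineSpan]
    exact hv
  rw [vectorSpan_def] at hvc
  have hle : Submodule.span ℝ ((c : Set (E d)) -ᵥ (c : Set (E d))) ≤ (ℝ ∙ n)ᗮ := by
    rw [Submodule.span_le]
    rintro _ ⟨a, ha, b, hb, rfl⟩
    refine Submodule.mem_orthogonal_singleton_iff_inner_right.2 ?_
    have : a -ᵥ b = (a - x) - (b - x) := by simp
    simp only [this]
    rw [inner_sub_right, key a ha, key b hb, sub_zero]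
  exact Submodule.mem_orthogonal_singleton_iff_inner_right.1 (hle hvc)

/-- A continuous function that vanishes almost everywhere on a polytope vanishes on it. -/
theorem IsPolytope.eq_zero_of_ae {d m : ℕ} {S : Set (E d)} (h : IsPolytope m S) {g : E d → ℝ}
    (hg : Continuous g) (h0 : ∀ᵐ x ∂(μHE[m] : Measure (E d)).restrict S, g x = 0) {x : E d}
    (hx : x ∈ S) : g x = 0 := by
  by_contra hne
  have hU : {y | g y ≠ 0} ∈ 𝓝 x := (isOpen_ne_fun hg continuous_const).mem_nhds hne
  refine h.measure_inter_ne_zero hx hU ?_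
  rw [ae_restrict_iff' h.isCompact.measurableSet] at h0
  refine measure_mono_null (fun y hy => ?_) (ae_iff.1 h0)
  exact fun h' => hy.2 (h' hy.1)

theorem IsPolytope.frequently_ae {d m : ℕ} {S : Set (E d)} (h : IsPolytope m S) {p : E d → Prop}
    (hp : ∀ᵐ x ∂(μHE[m] : Measure (E d)).restrict S, p x) : ∃ x ∈ S, p x := by
  by_contra! hcon
  obtain ⟨x, hx⟩ := h.1
  refine h.measure_inter_ne_zero hx univ_mem ?_
  rw [ae_restrict_iff' h.isCompact.measurableSet] at hp
  refine measure_mono_null (fun y hy => ?_) (ae_iff.1 hp)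
  exact fun h' => hcon y hy.1 (h' hy.1)

namespace PolytopalMesh

variable {d : ℕ} {Ω : Set (E d)} {ι κ : Type*} (M : PolytopalMesh d Ω ι κ)

theorem isClosed_cell (i : ι) : IsClosed (M.cell i) := (M.cell_polytope i).isCompact.isClosed

theorem isClosed_face (σ : κ) : IsClosed (M.face σ) := (M.face_polytope σ).isCompact.isClosed

theorem frontier_subset_cell (i : ι) : frontier (M.cell i) ⊆ M.cell i :=
  (M.isClosed_cell i).frontier_subset

theorem ae_normal_outward {i : ι} {σ : κ} (h : M.face σ ⊆ frontier (M.cell i)) :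
    ∀ᵐ x ∂(μHE[d - 1] : Measure (E d)).restrict (M.face σ),
      ∀ᶠ y in 𝓝 x, y ∈ M.cell i ↔ ⟪M.normal i σ, y - x⟫ ≤ 0 :=
  (ae_subtype_hausdorff (M.isClosed_face σ)).1 (M.normal_outward i σ h)

/-- Choose a point of the face at which the element is locally a half-space. Nearby face points
belong to the frontier, so they cannot be strictly inside the half-space (they would be interior)
nor strictly outside (the element is closed). The face is thus orthogonal to the normal near that
point, hence everywhere. -/
theorem inner_normal_of_mem_vectorSpan {i : ι} {σ : κ} (h : M.face σ ⊆ frontier (M.cell i))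
    {v : E d} (hv : v ∈ vectorSpan ℝ (M.face σ)) : ⟪M.normal i σ, v⟫ = 0 := by
  obtain ⟨x, hx, hloc⟩ := (M.face_polytope σ).frequently_ae (M.ae_normal_outward h)
  refine (M.face_polytope σ).inner_eq_zero_of_eventually hx ?_ hv
  filter_upwards [hloc.eventually_nhds] with y hy hyS
  have hyfr := h hyS
  have hc : Continuous fun z : E d => ⟪M.normal i σ, z - x⟫ := by fun_prop
  rcases lt_trichotomy ⟪M.normal i σ, y - x⟫ 0 with h1 | h1 | h1
  · have : y ∈ interior (M.cell i) := by
      rw [mem_interior_iff_mem_nhds]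
      filter_upwards [hy, hc.continuousAt.eventually_lt_const h1] with z hz hz1
      exact hz.2 hz1.le
    exact absurd this hyfr.2
  · exact h1
  · exact absurd (hy.self_of_nhds.1 (M.frontier_subset_cell i hyfr)) (not_le.2 h1)

/-- The inclusion is an equality because both spaces have dimension `d - 1`. -/
theorem vectorSpan_face {i : ι} {σ : κ} (h : M.face σ ⊆ frontier (M.cell i)) :
    vectorSpan ℝ (M.face σ) = (ℝ ∙ M.normal i σ)ᗮ := by
  refine Submodule.eq_of_le_of_finrank_eq (fun v hv =>
    Submodule.mem_orthogonal_singleton_iff_inner_right.2 (M.inner_normal_of_mem_vectorSpan h hv)) ?_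
  rw [finrank_orthogonal_unit (M.norm_normal i σ h), (M.face_polytope σ).2.1]

/-- The hyperplane that contains a face. -/
theorem mem_affineSpan_face {i : ι} {σ : κ} (h : M.face σ ⊆ frontier (M.cell i)) {x y : E d}
    (hx : x ∈ M.face σ) :
    y ∈ affineSpan ℝ (M.face σ) ↔ ⟪M.normal i σ, y - x⟫ = 0 := by
  rw [← Submodule.mem_orthogonal_singleton_iff_inner_right, ← M.vectorSpan_face h,
    ← direction_affineSpan]
  exact (AffineSubspace.vsub_right_mem_direction_iff_mem (subset_affineSpan ℝ _ hx) y).symm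

/-- The normals on faces in the same hyperplane agree up to sign. -/
theorem normal_eq_of_affineSpan_eq {i j : ι} {σ τ : κ} (hσ : M.face σ ⊆ frontier (M.cell i))
    (hτ : M.face τ ⊆ frontier (M.cell j))
    (h : affineSpan ℝ (M.face τ) = affineSpan ℝ (M.face σ)) :
    M.normal j τ = M.normal i σ ∨ M.normal j τ = -M.normal i σ := by
  have h1 : (ℝ ∙ M.normal j τ)ᗮ = (ℝ ∙ M.normal i σ)ᗮ := by
    rw [← M.vectorSpan_face hσ, ← M.vectorSpan_face hτ, ← direction_affineSpan,
      ← direction_affineSpan, h]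
  have h2 : M.normal j τ ∈ (ℝ ∙ M.normal i σ) := by
    rw [← Submodule.orthogonal_orthogonal (ℝ ∙ M.normal i σ), ← h1,
      Submodule.orthogonal_orthogonal]
    exact Submodule.mem_span_singleton_self _
  obtain ⟨a, ha⟩ := Submodule.mem_span_singleton.1 h2
  have h3 := M.norm_normal j τ hτ
  rw [← ha, norm_smul, M.norm_normal i σ hσ, mul_one, Real.norm_eq_abs] at h3
  rcases eq_or_eq_neg_of_abs_eq h3 with rfl | rfl
  · left; rw [← ha, one_smul]
  · right; rw [← ha, neg_one_smul]

/-- The hyperplane of another face meets a face in a set of measure zero. -/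
theorem measure_face_inter_affineSpan {i : ι} {σ τ : κ} (hσ : M.face σ ⊆ frontier (M.cell i))
    (h : affineSpan ℝ (M.face τ) ≠ affineSpan ℝ (M.face σ)) :
    μHE[d - 1] (M.face σ ∩ affineSpan ℝ (M.face τ)) = 0 := by
  obtain ⟨x, hx⟩ := (M.face_polytope σ).1
  set n := M.normal i σ
  have hn : ‖n‖ = 1 := M.norm_normal i σ hσ
  let f : (ℝ ∙ n)ᗮ →ᵃ[ℝ] E d :=
    (AffineEquiv.vaddConst ℝ x).toAffineMap.comp (ℝ ∙ n)ᗮ.subtype.toAffineMap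
  have hfapp : ∀ w, f w = w + x := fun w => rfl
  -- A hyperplane containing that of `σ` would equal it by dimension. So the trace on the hyperplane
  -- of `σ` is a proper affine subspace, which is a null set.
  have hne : (affineSpan ℝ (M.face τ)).comap f ≠ ⊤ := by
    intro htop
    refine h (Eq.symm ?_)
    refine AffineSubspace.eq_of_direction_eq_of_nonempty_of_le ?_
      ⟨x, subset_affineSpan ℝ _ hx⟩ ?_
    · have hle : affineSpan ℝ (M.face σ) ≤ affineSpan ℝ (M.face τ) := by
        intro y hy
        obtain ⟨w, hw⟩ := mem_range_add_orthogonal.2 ((M.mem_affineSpan_face hσ hx).1 hy)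
        have : w ∈ (affineSpan ℝ (M.face τ)).comap f := by rw [htop]; trivial
        rw [← hw]
        exact this
      refine Submodule.eq_of_le_of_finrank_eq (AffineSubspace.direction_le hle) ?_
      rw [direction_affineSpan, direction_affineSpan, (M.face_polytope σ).2.1,
        (M.face_polytope τ).2.1]
    · intro y hy
      obtain ⟨w, hw⟩ := mem_range_add_orthogonal.2 ((M.mem_affineSpan_face hσ hx).1 hy)
      have : w ∈ (affineSpan ℝ (M.face τ)).comap f := by rw [htop]; trivial
      rw [← hw]
      exact this
  have h0 := Measure.addHaar_affineSubspace volume _ hne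
  have hiso : Isometry f := isometry_add_orthogonal n x
  rw [← volume_orthogonal_unit hn, ← hiso.euclideanHausdorffMeasure_image] at h0
  refine measure_mono_null ?_ h0
  rintro y ⟨hy1, hy2⟩
  obtain ⟨w, hw⟩ := mem_range_add_orthogonal.2
    ((M.mem_affineSpan_face hσ hx).1 (subset_affineSpan ℝ _ hy1))
  refine ⟨w, ?_, hw⟩
  show f w ∈ affineSpan ℝ (M.face τ)
  have : f w = y := hw
  rw [this]
  exact hy2

variable [Fintype κ]

theorem mem_faces {i : ι} {σ : κ} : σ ∈ M.faces i ↔ M.face σ ⊆ frontier (M.cell i) := by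
  simp [faces]

theorem exists_mem_face {i : ι} {x : E d} (hx : x ∈ frontier (M.cell i)) :
    ∃ σ ∈ M.faces i, x ∈ M.face σ := by
  rw [M.frontier_cell i] at hx
  obtain ⟨σ, hσ, hxσ⟩ := mem_iUnion₂.1 hx
  exact ⟨σ, M.mem_faces.2 hσ, hxσ⟩

/-- Finitely many affine spans of faces cover the frontier, and each is proper because a unit step
along the normal leaves it. -/
theorem volume_frontier (i : ι) : volume (frontier (M.cell i)) = 0 := by
  have hsub : frontier (M.cell i) ⊆ ⋃ σ ∈ M.faces i, (affineSpan ℝ (M.face σ) : Set (E d)) := by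
    intro x hx
    obtain ⟨σ, hσ, hxσ⟩ := M.exists_mem_face hx
    exact mem_iUnion₂.2 ⟨σ, hσ, subset_affineSpan ℝ _ hxσ⟩
  refine measure_mono_null hsub ((measure_biUnion_null_iff (M.faces i).countable_toSet).2 ?_)
  intro σ hσ
  refine Measure.addHaar_affineSubspace volume _ fun htop => ?_
  have h := M.mem_faces.1 hσ
  obtain ⟨x, hx⟩ := (M.face_polytope σ).1
  have h1 : x + M.normal i σ ∈ affineSpan ℝ (M.face σ) := by rw [htop]; trivial
  have h2 := (M.mem_affineSpan_face h hx).1 h1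
  simp [M.norm_normal i σ h] at h2

end PolytopalMesh

/-! ### The divergence theorem on an element in a fixed direction -/

theorem ae_hyperplane {d : ℕ} {n : E d} (hn : ‖n‖ = 1) (x₀ : E d) {p : E d → Prop}
    (h : ∀ᵐ x ∂(μHE[d - 1] : Measure (E d)), p x) : ∀ᵐ w : (ℝ ∙ n)ᗮ, p (w + x₀) := by
  have he := (isometry_add_orthogonal n x₀).isClosedEmbedding.measurableEmbedding
  rw [← he.ae_map_iff (μ := volume) (p := p), map_volume_orthogonal hn]
  exact ae_restrict_of_ae h

/-- Only a frontier point could produce a jump, and there the indicator function is dominated by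
`|g|`, which tends to zero. -/
theorem tendsto_indicator_of_frontier {d : ℕ} {T : Set (E d)} {g : E d → ℝ} (hg : Continuous g)
    {x : E d} (hx : x ∈ frontier T → g x = 0) :
    Tendsto (T.indicator g) (𝓝 x) (𝓝 (T.indicator g x)) := by
  by_cases hint : x ∈ interior T
  · rw [indicator_of_mem (interior_subset hint)]
    refine (hg.tendsto x).congr' ?_
    filter_upwards [isOpen_interior.mem_nhds hint] with y hy
    exact (indicator_of_mem (interior_subset hy) g).symm
  by_cases hcl : x ∈ closure T
  · have h0 := hx ⟨hcl, hint⟩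
    have h1 : T.indicator g x = 0 := by by_cases h : x ∈ T <;> simp [h, h0]
    rw [h1]
    refine squeeze_zero_norm (a := fun y => ‖g y‖) (fun y => norm_indicator_le_norm_self g y) ?_
    have := (hg.tendsto x).norm
    rwa [h0, norm_zero] at this
  · rw [indicator_of_notMem fun h => hcl (subset_closure h)]
    refine tendsto_const_nhds.congr' ?_
    filter_upwards [isClosed_closure.isOpen_compl.mem_nhds hcl] with y hy
    exact (indicator_of_notMem (fun h => hy (subset_closure h)) g).symm

theorem tendsto_line {d : ℕ} (n x : E d) : Tendsto (fun t : ℝ => t • n + x) (𝓝 0) (𝓝 x) := by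
  have : Continuous fun t : ℝ => t • n + x := by fun_prop
  simpa using this.tendsto 0

namespace PolytopalMesh

variable {d : ℕ} {Ω : Set (E d)} {ι κ : Type*} (M : PolytopalMesh d Ω ι κ)

/-- The integral of a partial derivative over an element vanishes if the polynomial vanishes to
second order on the boundary. -/
theorem setIntegral_pderiv_eq_zero (i : ι) (j : Fin d) {g : MvPolynomial (Fin d) ℝ}
    (hg : ∀ x ∈ frontier (M.cell i), pval g x = 0 ∧ pval (MvPolynomial.pderiv j g) x = 0) :
    ∫ x in M.cell i, pval (MvPolynomial.pderiv j g) x = 0 := by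
  set n : E d := EuclideanSpace.single j 1
  have hn : ‖n‖ = 1 := by simp [n]
  have hsum : ∀ x, ∑ l, n l * pval (MvPolynomial.pderiv l g) x =
      pval (MvPolynomial.pderiv j g) x := by
    intro x
    rw [Finset.sum_eq_single j]
    · simp [n]
    · intro l _ hl
      simp [n, hl]
    · simp
  -- Since `g` vanishes on the whole frontier, there is no jump at any hyperplane, and the base
  -- point `0` is arbitrary.
  have := setIntegral_deriv_eq_integral_jump (M.cell_polytope i).isCompact hn 0
    (g := pval g) (g' := pval (MvPolynomial.pderiv j g)) (continuous_pval _) (fun y t => by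
      have := hasDerivAt_pval g n y t
      rwa [hsum] at this) (fun x hx _ => hg x hx) (J := 0) ?_
  · simpa using this
  · refine Eventually.of_forall fun w => ?_
    have hlim := (tendsto_indicator_of_frontier (T := M.cell i) (continuous_pval g)
      fun h => (hg _ h).1).comp (tendsto_line n ((w : E d) + 0))
    exact ⟨_, _, hlim.mono_left nhdsWithin_le_nhds, hlim.mono_left nhdsWithin_le_nhds,
      sub_self _⟩

instance isFiniteMeasure_face (σ : κ) :
    IsFiniteMeasure ((μHE[d - 1] : Measure (E d)).restrict (M.face σ)) :=
  ⟨by simpa using (M.face_polytope σ).measure_lt_top⟩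

theorem integrableOn_face (σ : κ) (p : MvPolynomial (Fin d) ℝ) :
    IntegrableOn (pval p) (M.face σ) (μHE[d - 1] : Measure (E d)) := by
  obtain ⟨C, hC⟩ := (M.face_polytope σ).isCompact.exists_bound_of_continuousOn
    (continuous_pval p).continuousOn
  exact Integrable.of_bound (continuous_pval p).aestronglyMeasurable C
    (ae_restrict_of_forall_mem (M.isClosed_face σ).measurableSet hC)

/-- There are finitely many pairs of faces, each with null overlap. Almost every point of a face
therefore belongs to that face alone. -/
theorem ae_notMem_other_face [Fintype κ] :
    ∀ᵐ x ∂(μHE[d - 1] : Measure (E d)), ∀ τ τ', τ ≠ τ' → x ∈ M.face τ → x ∉ M.face τ' := by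
  rw [eventually_all]
  intro τ
  rw [eventually_all]
  intro τ'
  by_cases h : τ = τ'
  · simp [h]
  · refine (measure_eq_zero_iff_ae_notMem.1 (M.face_disjoint τ τ' h)).mono ?_
    exact fun x hx _ h1 h2 => hx ⟨h1, h2⟩

variable [Fintype κ]

/-- The divergence theorem on an element for a polynomial field in the direction of the normal on a
face, which vanishes to second order on the faces outside the hyperplane of that face. -/
theorem setIntegral_normalDeriv {i : ι} {σ : κ} (hσ : σ ∈ M.faces i)
    {g : MvPolynomial (Fin d) ℝ}
    (hg : ∀ τ ∈ M.faces i, affineSpan ℝ (M.face τ) ≠ affineSpan ℝ (M.face σ) →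
      ∀ x ∈ M.face τ, pval g x = 0 ∧ ∀ j, pval (MvPolynomial.pderiv j g) x = 0) :
    ∫ x in M.cell i, ∑ j, M.normal i σ j * pval (MvPolynomial.pderiv j g) x =
      ∑ τ ∈ M.faces i, ⟪M.normal i σ, M.normal i τ⟫ * ∫ x in M.face τ, pval g x ∂μHE[d - 1] := by
  classical
  have hσ' := M.mem_faces.1 hσ
  set n := M.normal i σ with hndef
  have hn : ‖n‖ = 1 := M.norm_normal i σ hσ'
  obtain ⟨x₀, hx₀⟩ := (M.face_polytope σ).1
  have hplane : ∀ τ ∈ M.faces i, affineSpan ℝ (M.face τ) = affineSpan ℝ (M.face σ) →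
      ∀ x ∈ M.face τ, ⟪n, x - x₀⟫ = 0 := by
    intro τ _ he x hx
    refine (M.mem_affineSpan_face hσ' hx₀).1 ?_
    rw [← he]
    exact subset_affineSpan ℝ _ hx
  -- The jump of the indicator function at height `0`. For coplanar faces the coefficient is `±1`
  -- and records on which side of the hyperplane the element lies; the other faces contribute zero
  -- because `g` vanishes on them.
  let J : (ℝ ∙ n)ᗮ → ℝ := fun w => ∑ τ ∈ M.faces i,
    if affineSpan ℝ (M.face τ) = affineSpan ℝ (M.face σ) then
      ⟪n, M.normal i τ⟫ * (M.face τ).indicator (pval g) (w + x₀) else 0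
  have hJint : ∫ w, J w =
      ∑ τ ∈ M.faces i, ⟪n, M.normal i τ⟫ * ∫ x in M.face τ, pval g x ∂μHE[d - 1] := by
    rw [integral_finsetSum]
    · refine Finset.sum_congr rfl fun τ hτ => ?_
      split_ifs with he
      · rw [integral_const_mul, setIntegral_hyperplane hn x₀ (M.isClosed_face τ)
          (hplane τ hτ he)]
      · rw [setIntegral_eq_zero_of_forall_eq_zero fun x hx => (hg τ hτ he x hx).1]
        simp
    · intro τ _
      split_ifs with he
      · refine Integrable.const_mul ?_ _
        have hiso := isometry_add_orthogonal n x₀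
        have hK := hiso.isClosedEmbedding.isCompact_preimage (M.face_polytope τ).isCompact
        exact (((continuous_pval g).comp hiso.continuous).continuousOn.integrableOn_compact
          hK).integrable_indicator hK.measurableSet
      · exact integrable_zero _ _ _
  rw [← hJint]
  refine setIntegral_deriv_eq_integral_jump (M.cell_polytope i).isCompact hn x₀ (g := pval g)
    (continuous_finsetSum _ fun j _ => continuous_const.mul (continuous_pval _))
    (fun y t => hasDerivAt_pval g n y t) ?_ ?_
  · intro x hx hne
    obtain ⟨τ, hτ, hxτ⟩ := M.exists_mem_face hx
    have he : affineSpan ℝ (M.face τ) ≠ affineSpan ℝ (M.face σ) := fun he =>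
      hne (hplane τ hτ he x hxτ)
    obtain ⟨h1, h2⟩ := hg τ hτ he x hxτ
    exact ⟨h1, by simp [h2]⟩
  have hae1 : ∀ᵐ x ∂(μHE[d - 1] : Measure (E d)), ∀ τ ∈ M.faces i, x ∈ M.face τ →
      ∀ᶠ y in 𝓝 x, y ∈ M.cell i ↔ ⟪M.normal i τ, y - x⟫ ≤ 0 := by
    rw [eventually_all_finset]
    intro τ hτ
    exact (ae_restrict_iff' (M.isClosed_face τ).measurableSet).1
      (M.ae_normal_outward (M.mem_faces.1 hτ))
  filter_upwards [ae_hyperplane hn x₀ hae1, ae_hyperplane hn x₀ M.ae_notMem_other_face] with w hw1 hw2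
  set p : E d := w + x₀ with hp
  have htg := (continuous_pval g).tendsto p
  by_cases hex : ∃ τ ∈ M.faces i, affineSpan ℝ (M.face τ) = affineSpan ℝ (M.face σ) ∧
      p ∈ M.face τ
  · obtain ⟨τ, hτ, he, hpτ⟩ := hex
    have hJw : J w = ⟪n, M.normal i τ⟫ * pval g p := by
      simp only [J]
      rw [Finset.sum_eq_single τ]
      · rw [if_pos he, indicator_of_mem hpτ]
      · intro τ' _ hne
        rw [indicator_of_notMem (hw2 τ τ' hne.symm hpτ)]
        simp
      · exact fun h => absurd hτ h
    have hloc := (tendsto_line n p).eventually (hw1 τ hτ hpτ)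
    have htl := htg.comp (tendsto_line n p)
    have hnn : ⟪n, n⟫ = 1 := by rw [real_inner_self_eq_norm_sq, hn, one_pow]
    have hcalc : ∀ t : ℝ, ⟪n, t • n + p - p⟫ = t := by
      intro t
      rw [add_sub_cancel_right, inner_smul_right, hnn, mul_one]
    -- With equal normals the element occupies `t ≤ 0` near the crossing, so the one-sided limits
    -- are `g p` and `0`. With opposite normals they are interchanged.
    rcases M.normal_eq_of_affineSpan_eq hσ' (M.mem_faces.1 hτ) he with hs | hs
    · rw [hs, ← hndef] at hloc hJw
      refine ⟨pval g p, 0, (htl.mono_left nhdsWithin_le_nhds).congr' ?_,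
        tendsto_const_nhds.congr' ?_, by rw [hJw, hnn]; ring⟩
      · filter_upwards [hloc.filter_mono nhdsWithin_le_nhds, self_mem_nhdsWithin] with t ht ht0
        rw [hcalc] at ht
        exact (indicator_of_mem (ht.2 (mem_Iio.1 ht0).le) _).symm
      · filter_upwards [hloc.filter_mono nhdsWithin_le_nhds, self_mem_nhdsWithin] with t ht ht0
        rw [hcalc] at ht
        exact (indicator_of_notMem (fun h => absurd (ht.1 h) (not_le.2 ht0)) _).symm
    · rw [hs, ← hndef] at hloc hJw
      refine ⟨0, pval g p, tendsto_const_nhds.congr' ?_,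
        (htl.mono_left nhdsWithin_le_nhds).congr' ?_, by rw [hJw, inner_neg_right, hnn]; ring⟩
      · filter_upwards [hloc.filter_mono nhdsWithin_le_nhds, self_mem_nhdsWithin] with t ht ht0
        rw [inner_neg_left, hcalc] at ht
        refine (indicator_of_notMem (fun h => ?_) _).symm
        have := ht.1 h
        have := mem_Iio.1 ht0
        linarith
      · filter_upwards [hloc.filter_mono nhdsWithin_le_nhds, self_mem_nhdsWithin] with t ht ht0
        rw [inner_neg_left, hcalc] at ht
        have := mem_Ioi.1 ht0
        exact (indicator_of_mem (ht.2 (by linarith)) _).symm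
  · push Not at hex
    have hJw : J w = 0 := by
      refine Finset.sum_eq_zero fun τ hτ => ?_
      split_ifs with he
      · rw [indicator_of_notMem (hex τ hτ he), mul_zero]
      · rfl
    -- If the crossing point lies on the frontier at all, it lies on a face outside the hyperplane,
    -- where `g` vanishes. So there is no jump.
    have htend := (tendsto_indicator_of_frontier (T := M.cell i) (continuous_pval g) (x := p)
      fun hfr => by
        obtain ⟨τ, hτ, hpτ⟩ := M.exists_mem_face hfr
        exact (hg τ hτ (fun he => hex τ hτ he hpτ) p hpτ).1).comp (tendsto_line n p)
    exact ⟨_, _, htend.mono_left nhdsWithin_le_nhds, htend.mono_left nhdsWithin_le_nhds, by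
      rw [hJw, sub_self]⟩

end PolytopalMesh

/-! ### Polynomial functions and the affine function of a hyperplane -/

section Polynomial

variable {d : ℕ}

@[simp] theorem pval_add (p p' : MvPolynomial (Fin d) ℝ) (x : E d) :
    pval (p + p') x = pval p x + pval p' x := by simp [pval]

@[simp] theorem pval_sub (p p' : MvPolynomial (Fin d) ℝ) (x : E d) :
    pval (p - p') x = pval p x - pval p' x := by simp [pval]

@[simp] theorem pval_mul (p p' : MvPolynomial (Fin d) ℝ) (x : E d) :
    pval (p * p') x = pval p x * pval p' x := by simp [pval]

@[simp] theorem pval_smul (c : ℝ) (p : MvPolynomial (Fin d) ℝ) (x : E d) :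
    pval (c • p) x = c * pval p x := by simp [pval]

@[simp] theorem pval_C (c : ℝ) (x : E d) : pval (MvPolynomial.C c) x = c := by simp [pval]

@[simp] theorem pval_zero (x : E d) : pval (0 : MvPolynomial (Fin d) ℝ) x = 0 := by simp [pval]

@[simp] theorem pval_sum {α : Type*} (s : Finset α) (p : α → MvPolynomial (Fin d) ℝ) (x : E d) :
    pval (∑ a ∈ s, p a) x = ∑ a ∈ s, pval (p a) x := by simp [pval]

@[simp] theorem pval_prod {α : Type*} (s : Finset α) (p : α → MvPolynomial (Fin d) ℝ) (x : E d) :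
    pval (∏ a ∈ s, p a) x = ∏ a ∈ s, pval (p a) x := by simp [pval]

theorem eq_C_of_pderiv_eq_zero {p : MvPolynomial (Fin d) ℝ}
    (h : ∀ j, MvPolynomial.pderiv j p = 0) : p = MvPolynomial.C (pval p 0) := by
  have hconst : ∀ x : E d, pval p x = pval p 0 := by
    intro x
    have hd : ∀ t : ℝ, HasDerivAt (fun t : ℝ => pval p (t • x + 0)) 0 t := by
      intro t
      simpa [h] using hasDerivAt_pval p x 0 t
    have := is_const_of_deriv_eq_zero (fun t => (hd t).differentiableAt) (fun t => (hd t).deriv) 1 0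
    simpa using this
  refine MvPolynomial.funext fun y => ?_
  have := hconst (WithLp.toLp 2 y)
  simpa [pval] using this

theorem totalDegree_pderiv_le (j : Fin d) (p : MvPolynomial (Fin d) ℝ) :
    (MvPolynomial.pderiv j p).totalDegree ≤ p.totalDegree - 1 := by
  refine Finset.sup_le fun m hm => ?_
  rw [MvPolynomial.mem_support_iff, MvPolynomial.coeff_pderiv] at hm
  have h1 := MvPolynomial.le_totalDegree (MvPolynomial.mem_support_iff.2 (left_ne_zero_of_mul hm))
  rw [Finsupp.sum_add_index' (fun _ => rfl) (fun _ _ _ => rfl),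
    Finsupp.sum_single_index rfl] at h1
  omega

/-- By the product rule each partial derivative of `p² a` keeps a factor `p`. This gives the
second-order vanishing that the divergence theorem requires, and is one reason why bubbles enter
squared. -/
theorem pval_eq_zero_of_sq_dvd {p g : MvPolynomial (Fin d) ℝ} (h : p ^ 2 ∣ g) {x : E d}
    (hx : pval p x = 0) : pval g x = 0 ∧ ∀ j, pval (MvPolynomial.pderiv j g) x = 0 := by
  obtain ⟨a, rfl⟩ := h
  simp [pow_two, Derivation.leibniz, hx]

/-- The affine function that vanishes on the hyperplane through `x₀` with normal `n`. -/
noncomputable def hyperplanePoly (n x₀ : E d) : MvPolynomial (Fin d) ℝ :=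
  ∑ j, MvPolynomial.C (n j) * (MvPolynomial.X j - MvPolynomial.C (x₀ j))

theorem pval_hyperplanePoly (n x₀ x : E d) : pval (hyperplanePoly n x₀) x = ⟪n, x - x₀⟫ := by
  simp [hyperplanePoly, pval, PiLp.inner_apply, mul_comm]

theorem totalDegree_hyperplanePoly (n x₀ : E d) : (hyperplanePoly n x₀).totalDegree ≤ 1 := by
  refine MvPolynomial.totalDegree_finsetSum_le fun j _ => ?_
  refine (MvPolynomial.totalDegree_mul _ _).trans ?_
  rw [MvPolynomial.totalDegree_C, zero_add]
  refine (MvPolynomial.totalDegree_sub _ _).trans ?_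
  simp

theorem hyperplanePoly_ne_zero {n : E d} (hn : ‖n‖ = 1) (x₀ : E d) : hyperplanePoly n x₀ ≠ 0 := by
  intro h
  have := pval_hyperplanePoly n x₀ (x₀ + n)
  simp [h, hn] at this

end Polynomial

/-! ### Bubble functions and the interior part of a weak function -/

namespace PolytopalMesh

variable {d : ℕ} {Ω : Set (E d)} {ι κ : Type*} (M : PolytopalMesh d Ω ι κ)

/-- The affine function that vanishes on the hyperplane of a face. -/
noncomputable def facePoly (i : ι) (σ : κ) : MvPolynomial (Fin d) ℝ :=
  hyperplanePoly (M.normal i σ) (M.face_polytope σ).1.choose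

/-- The product of the affine functions that vanish on the hyperplanes of the given faces. -/
noncomputable def bubble (i : ι) (S : Finset κ) : MvPolynomial (Fin d) ℝ :=
  ∏ σ ∈ S, M.facePoly i σ

theorem totalDegree_bubble (i : ι) (S : Finset κ) : (M.bubble i S).totalDegree ≤ S.card := by
  refine (MvPolynomial.totalDegree_finsetProd _ _).trans ?_
  refine (Finset.sum_le_card_nsmul S _ 1 fun σ _ => totalDegree_hyperplanePoly _ _).trans ?_
  simp

theorem exists_face_repr {k q : ℕ} (v : M.Vh k q) : ∃ b : κ → MvPolynomial (Fin d) ℝ,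
    ∀ σ, (b σ).totalDegree ≤ q ∧ ∀ x : M.face σ, (v.2 σ : M.face σ → ℝ) x = pval (b σ) x := by
  have : ∀ σ, ∃ b : MvPolynomial (Fin d) ℝ,
      b.totalDegree ≤ q ∧ ∀ x : M.face σ, (v.2 σ : M.face σ → ℝ) x = pval b x := by
    intro σ
    obtain ⟨p, hp, he⟩ := (v.2 σ).2
    exact ⟨p, (MvPolynomial.mem_restrictTotalDegree _ _ _).1 hp, fun x => by rw [← he]; rfl⟩
  choose b hb using this
  exact ⟨b, hb⟩

variable [Fintype κ]

theorem pval_facePoly_eq_zero {i : ι} {σ : κ} (hσ : σ ∈ M.faces i) {x : E d} :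
    pval (M.facePoly i σ) x = 0 ↔ x ∈ affineSpan ℝ (M.face σ) := by
  rw [facePoly, pval_hyperplanePoly,
    M.mem_affineSpan_face (M.mem_faces.1 hσ) (M.face_polytope σ).1.choose_spec]

theorem bubble_ne_zero {i : ι} {S : Finset κ} (hS : S ⊆ M.faces i) : M.bubble i S ≠ 0 :=
  Finset.prod_ne_zero_iff.2 fun σ hσ =>
    hyperplanePoly_ne_zero (M.norm_normal i σ (M.mem_faces.1 (hS hσ))) _

theorem vanish_of_bubble_sq_dvd {i : ι} {S : Finset κ} (hS : S ⊆ M.faces i)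
    {g : MvPolynomial (Fin d) ℝ} (hg : M.bubble i S ^ 2 ∣ g) {σ : κ} (hσ : σ ∈ S) {x : E d}
    (hx : x ∈ M.face σ) : pval g x = 0 ∧ ∀ j, pval (MvPolynomial.pderiv j g) x = 0 := by
  refine pval_eq_zero_of_sq_dvd ((pow_dvd_pow_of_dvd (Finset.dvd_prod_of_mem _ hσ) 2).trans hg) ?_
  exact (M.pval_facePoly_eq_zero (hS hσ)).2 (subset_affineSpan ℝ _ hx)

/-- The weak functional in terms of polynomials that represent the face values. -/
theorem weakFunctional_eq {k q r : ℕ} (v : M.Vh k q) (i : ι) (φ : PolyField d r)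
    {b : κ → MvPolynomial (Fin d) ℝ}
    (hb : ∀ σ (x : M.face σ), (v.2 σ : M.face σ → ℝ) x = pval (b σ) x) :
    M.weakFunctional v i φ =
      -(∫ x in M.cell i, pval (v.1 i : MvPolynomial (Fin d) ℝ) x * pval (divergence φ) x)
      + ∑ σ ∈ M.faces i, ∫ x in M.face σ, pval (b σ) x *
          ∑ j, pval (φ j : MvPolynomial (Fin d) ℝ) x * M.normal i σ j ∂μHE[d - 1] := by
  rw [weakFunctional]
  congr 1
  refine Finset.sum_congr rfl fun σ _ => ?_
  rw [← integral_subtype_hausdorff (M.isClosed_face σ)]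
  simp only [hb]

/-- If the weak functional vanishes, the interior part of the weak function is constant. -/
theorem exists_eq_C {k q r : ℕ} {i : ι} (hr : 2 * (M.faces i).card + k - 1 ≤ r) {v : M.Vh k q}
    (hv : ∀ φ : PolyField d r, M.weakFunctional v i φ = 0) :
    ∃ c : ℝ, (v.1 i : MvPolynomial (Fin d) ℝ) = MvPolynomial.C c := by
  obtain ⟨b, hb⟩ := M.exists_face_repr v
  set p : MvPolynomial (Fin d) ℝ := (v.1 i : MvPolynomial (Fin d) ℝ) with hp
  have hpk : p.totalDegree ≤ k := (MvPolynomial.mem_restrictTotalDegree _ _ _).1 (v.1 i).2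
  set B := M.bubble i (M.faces i) with hB
  have hBdeg : (B ^ 2).totalDegree ≤ 2 * (M.faces i).card :=
    (MvPolynomial.totalDegree_pow _ _).trans (by gcongr; exact M.totalDegree_bubble _ _)
  -- The components of the test field `B² ∇p`. Their degree is at most `2N + (k - 1)` if `k ≥ 1`;
  -- for `k = 0` the gradient is zero, so the truncated subtraction does no harm.
  have hdeg : ∀ j, B ^ 2 * MvPolynomial.pderiv j p ∈
      MvPolynomial.restrictTotalDegree (Fin d) ℝ r := by
    intro j
    rw [MvPolynomial.mem_restrictTotalDegree]
    rcases Nat.eq_zero_or_pos k with rfl | hk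
    · have : p = MvPolynomial.C (p.coeff 0) :=
        MvPolynomial.totalDegree_eq_zero_iff_eq_C.1 (Nat.le_zero.1 hpk)
      rw [this]
      simp
    · have h1 := MvPolynomial.totalDegree_mul (B ^ 2) (MvPolynomial.pderiv j p)
      have h2 := totalDegree_pderiv_le j p
      omega
  have hfr : ∀ g : MvPolynomial (Fin d) ℝ, B ^ 2 ∣ g → ∀ x ∈ frontier (M.cell i),
      pval g x = 0 ∧ ∀ j, pval (MvPolynomial.pderiv j g) x = 0 := by
    intro g hg x hx
    obtain ⟨σ, hσ, hxσ⟩ := M.exists_mem_face hx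
    exact M.vanish_of_bubble_sq_dvd Subset.rfl hg hσ hxσ
  -- The face terms drop out because the field vanishes on the frontier, which leaves `∫ p ∇·(B² ∇p)
  -- = 0`.
  have h0 := hv fun j => ⟨_, hdeg j⟩
  rw [M.weakFunctional_eq v i _ fun σ => (hb σ).2, Finset.sum_eq_zero, add_zero, neg_eq_zero] at h0
  swap
  · intro σ hσ
    refine setIntegral_eq_zero_of_forall_eq_zero fun x hx => ?_
    rw [Finset.sum_eq_zero, mul_zero]
    intro j _
    rw [(hfr _ (dvd_mul_right _ _) x (M.mem_faces.1 hσ hx)).1, zero_mul]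
  have hi : ∀ g : MvPolynomial (Fin d) ℝ, IntegrableOn (pval g) (M.cell i) := fun g =>
    (continuous_pval g).continuousOn.integrableOn_compact (M.cell_polytope i).isCompact
  -- Integration by parts: `p B² ∂ⱼp` vanishes to second order on the frontier, so its `j`-th
  -- derivative has integral zero.
  have hparts : ∀ j, ∫ x in M.cell i,
      pval (p * MvPolynomial.pderiv j (B ^ 2 * MvPolynomial.pderiv j p)) x =
        -∫ x in M.cell i, pval (MvPolynomial.pderiv j p * B) x *
          pval (MvPolynomial.pderiv j p * B) x := by
    intro j
    have h1 := M.setIntegral_pderiv_eq_zero i j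
      (g := p * (B ^ 2 * MvPolynomial.pderiv j p)) fun x hx => by
        have := hfr (p * (B ^ 2 * MvPolynomial.pderiv j p))
          (Dvd.intro_left _ (by ring : p * MvPolynomial.pderiv j p * B ^ 2 = _)) x hx
        exact ⟨this.1, this.2 j⟩
    rw [MvPolynomial.pderiv_mul] at h1
    simp only [pval_add] at h1
    rw [integral_add (hi _) (hi _)] at h1
    rw [← neg_eq_iff_add_eq_zero] at h1
    rw [← h1]
    congr 1
    refine integral_congr_ae (Eventually.of_forall fun x => ?_)
    simp only [pval_mul, pow_two]
    ring
  have hsum : ∑ j, ∫ x in M.cell i, pval (MvPolynomial.pderiv j p * B) x *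
      pval (MvPolynomial.pderiv j p * B) x = 0 := by
    rw [← neg_eq_zero, ← Finset.sum_neg_distrib, ← h0]
    simp only [← hparts]
    rw [← integral_finsetSum _ fun j _ => hi _]
    simp only [divergence, pval_sum, Finset.mul_sum, pval_mul, ← hp]
  have hz := (Finset.sum_eq_zero_iff_of_nonneg fun j _ => integral_nonneg fun x =>
    mul_self_nonneg _).1 hsum
  refine ⟨pval p 0, eq_C_of_pderiv_eq_zero fun j => ?_⟩
  have := eq_zero_of_integral_sq (M.cell_polytope i) _ (hz j (Finset.mem_univ j))
  exact (mul_eq_zero.1 this).resolve_right (M.bubble_ne_zero Subset.rfl)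

/-- The weak functional of a weak function with constant interior part, for a field in the direction
of the normal on a face. -/
theorem weakFunctional_normal {k q r : ℕ} {v : M.Vh k q} {i : ι} {c : ℝ}
    (hc : (v.1 i : MvPolynomial (Fin d) ℝ) = MvPolynomial.C c) {b : κ → MvPolynomial (Fin d) ℝ}
    (hb : ∀ σ (x : M.face σ), (v.2 σ : M.face σ → ℝ) x = pval (b σ) x) {σ : κ}
    (hσ : σ ∈ M.faces i) (g : MvPolynomial.restrictTotalDegree (Fin d) ℝ r)
    (hg : ∀ τ ∈ M.faces i, affineSpan ℝ (M.face τ) ≠ affineSpan ℝ (M.face σ) →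
      ∀ x ∈ M.face τ, pval g.1 x = 0 ∧ ∀ j, pval (MvPolynomial.pderiv j g.1) x = 0) :
    M.weakFunctional v i (fun j => M.normal i σ j • g) = ∑ τ ∈ M.faces i,
      ⟪M.normal i σ, M.normal i τ⟫ *
        ∫ x in M.face τ, pval ((b τ - MvPolynomial.C c) * g.1) x ∂μHE[d - 1] := by
  rw [M.weakFunctional_eq v i _ hb, hc]
  have hdiv : ∀ x, pval (divergence fun j => M.normal i σ j • g) x =
      ∑ j, M.normal i σ j * pval (MvPolynomial.pderiv j g.1) x := by
    intro x
    simp [divergence]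
  simp only [pval_C, hdiv]
  -- The divergence theorem converts `c ∫ ∇·φ` into face integrals, which combine with the boundary
  -- terms so that `b τ` is replaced by `b τ - c`.
  rw [integral_const_mul, M.setIntegral_normalDeriv hσ hg, Finset.mul_sum,
    ← Finset.sum_neg_distrib, ← Finset.sum_add_distrib]
  refine Finset.sum_congr rfl fun τ _ => ?_
  have h1 : ∀ x, pval (b τ) x * ∑ j, pval (M.normal i σ j • g : _).1 x * M.normal i τ j =
      ⟪M.normal i σ, M.normal i τ⟫ * pval (b τ * g.1) x := by
    intro x
    simp only [PiLp.inner_apply, Submodule.coe_smul, pval_smul, pval_mul, Finset.mul_sum,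
      Finset.sum_mul]
    refine Finset.sum_congr rfl fun j _ => ?_
    simp
    ring
  have h2 : ∀ x, pval ((b τ - MvPolynomial.C c) * g.1) x = pval (b τ * g.1) x - c * pval g.1 x := by
    intro x
    simp [sub_mul]
  simp only [h1, h2]
  rw [integral_const_mul, integral_sub (M.integrableOn_face τ _) ((M.integrableOn_face τ _).const_mul c), integral_const_mul]
  ring

end PolytopalMesh

/-! ### The face values of a weak function -/

/-- An integrable function on a compact set that is orthogonal to all polynomials vanishes almost
everywhere. -/
theorem ae_eq_zero_of_integral_mul_pval {d : ℕ} {μ : Measure (E d)} {K : Set (E d)}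
    (hK : IsCompact K) (hμ : ∀ᵐ x ∂μ, x ∈ K) {w : E d → ℝ} (hw : Integrable w μ)
    (h : ∀ p : MvPolynomial (Fin d) ℝ, ∫ x, pval p x * w x ∂μ = 0) : ∀ᵐ x ∂μ, w x = 0 := by
  refine ae_eq_zero_of_integral_contDiff_smul_eq_zero hw.locallyIntegrable fun g hg hgs => ?_
  -- The algebra of polynomial functions separates points, so Stone–Weierstrass approximates the
  -- test function `g` uniformly on `K` by its elements.
  let A : Subalgebra ℝ C(E d, ℝ) := (MvPolynomial.aeval (R := ℝ)
    fun j : Fin d => (⟨fun x => x j, by fun_prop⟩ : C(E d, ℝ))).range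
  have hA : ∀ (p : MvPolynomial (Fin d) ℝ) (x : E d), (MvPolynomial.aeval (R := ℝ)
      fun j : Fin d => (⟨fun x => x j, by fun_prop⟩ : C(E d, ℝ))) p x = pval p x := by
    intro p x
    induction p using MvPolynomial.induction_on with
    | C a => simp
    | add p q hp hq => simp [hp, hq]
    | mul_X p i hp => rw [map_mul, ContinuousMap.mul_apply, hp]; simp [pval]
  have hsep : A.SeparatesPoints := by
    intro x y hxy
    obtain ⟨j, hj⟩ : ∃ j, x j ≠ y j := by
      by_contra! hcon
      exact hxy (PiLp.ext hcon)
    refine ⟨_, ⟨_, ⟨MvPolynomial.X j, rfl⟩, rfl⟩, ?_⟩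
    simpa using hj
  have hbd : ∀ p : MvPolynomial (Fin d) ℝ, Integrable (fun x => pval p x * w x) μ := by
    intro p
    obtain ⟨C, hC⟩ := hK.exists_bound_of_continuousOn (continuous_pval p).continuousOn
    exact hw.bdd_mul (continuous_pval p).aestronglyMeasurable (hμ.mono fun x hx => hC x hx)
  have hgi : Integrable (fun x => g x * w x) μ := by
    obtain ⟨C, hC⟩ := hK.exists_bound_of_continuousOn hg.continuous.continuousOn
    exact hw.bdd_mul hg.continuous.aestronglyMeasurable (hμ.mono fun x hx => hC x hx)
  have hle : ∀ ε : ℝ, 0 < ε → ‖∫ x, g x • w x ∂μ‖ ≤ ε * ∫ x, ‖w x‖ ∂μ := by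
    intro ε hε
    obtain ⟨_, ⟨p, rfl⟩, hp⟩ :=
      ContinuousMap.exists_mem_subalgebra_near_continuous_of_isCompact_of_separatesPoints hsep
        ⟨g, hg.continuous⟩ hK hε
    have h1 : ∫ x, g x • w x ∂μ = ∫ x, (g x * w x - pval p x * w x) ∂μ := by
      rw [integral_sub hgi (hbd p), h p, sub_zero]
      rfl
    rw [h1, ← integral_const_mul]
    refine norm_integral_le_of_norm_le (hw.norm.const_mul ε) ?_
    filter_upwards [hμ] with x hx
    rw [← sub_mul, norm_mul]
    refine mul_le_mul_of_nonneg_right ?_ (norm_nonneg _)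
    have := (hp x hx).le
    rw [norm_sub_rev]
    rw [← hA p x]
    exact this
  by_contra hne
  have hpos : 0 < ‖∫ x, g x • w x ∂μ‖ := norm_pos_iff.2 hne
  set I := ∫ x, ‖w x‖ ∂μ
  have hI0 : 0 ≤ I := integral_nonneg fun x => norm_nonneg _
  -- This `ε` makes `ε I` smaller than the norm; the `+ 1` covers `I = 0`.
  have h1 := hle (‖∫ x, g x • w x ∂μ‖ / (2 * (I + 1))) (by positivity)
  have h2 : ‖∫ x, g x • w x ∂μ‖ / (2 * (I + 1)) * I < ‖∫ x, g x • w x ∂μ‖ := by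
    rw [div_mul_eq_mul_div, div_lt_iff₀ (by positivity)]
    nlinarith
  linarith

namespace PolytopalMesh

variable {d : ℕ} {Ω : Set (E d)} {ι κ : Type*} (M : PolytopalMesh d Ω ι κ)

variable [Fintype κ]

/-- The faces of an element that do not lie in the hyperplane of a given face. -/
noncomputable def otherFaces (i : ι) (σ : κ) : Finset κ :=
  open Classical in
    (M.faces i).filter fun τ => affineSpan ℝ (M.face τ) ≠ affineSpan ℝ (M.face σ)

theorem mem_otherFaces {i : ι} {σ τ : κ} : τ ∈ M.otherFaces i σ ↔
    τ ∈ M.faces i ∧ affineSpan ℝ (M.face τ) ≠ affineSpan ℝ (M.face σ) := by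
  simp [otherFaces]

theorem otherFaces_subset (i : ι) (σ : κ) : M.otherFaces i σ ⊆ M.faces i :=
  fun _ hτ => (M.mem_otherFaces.1 hτ).1

theorem card_otherFaces_lt {i : ι} {σ : κ} (hσ : σ ∈ M.faces i) :
    (M.otherFaces i σ).card < (M.faces i).card :=
  Finset.card_lt_card ((Finset.ssubset_iff_of_subset (M.otherFaces_subset i σ)).2
    ⟨σ, hσ, fun h => (M.mem_otherFaces.1 h).2 rfl⟩)

/-- On `σ` the bubble can vanish only where the hyperplane of a non-coplanar face cuts `σ`, a null
set. So `p` vanishes almost everywhere on `σ`, and everywhere by continuity. -/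
theorem eq_of_ae_mul_bubble {i : ι} {σ : κ} (hσ : σ ∈ M.faces i) {p : MvPolynomial (Fin d) ℝ}
    (h : ∀ᵐ x ∂(μHE[d - 1] : Measure (E d)).restrict (M.face σ),
      pval (p * M.bubble i (M.otherFaces i σ)) x = 0) {x : E d} (hx : x ∈ M.face σ) :
    pval p x = 0 := by
  refine (M.face_polytope σ).eq_zero_of_ae (continuous_pval p) ?_ hx
  have h1 : ∀ᵐ x ∂(μHE[d - 1] : Measure (E d)).restrict (M.face σ), ∀ τ ∈ M.otherFaces i σ,
      pval (M.facePoly i τ) x ≠ 0 := by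
    rw [eventually_all_finset]
    intro τ hτ
    obtain ⟨hτ1, hτ2⟩ := M.mem_otherFaces.1 hτ
    rw [ae_restrict_iff' (M.isClosed_face σ).measurableSet]
    refine (measure_eq_zero_iff_ae_notMem.1
      (M.measure_face_inter_affineSpan (M.mem_faces.1 hσ) hτ2)).mono fun y hy hyσ h0 => ?_
    exact hy ⟨hyσ, (M.pval_facePoly_eq_zero hτ1).1 h0⟩
  filter_upwards [h, h1] with y hy hy1
  rw [pval_mul] at hy
  refine (mul_eq_zero.1 hy).resolve_right ?_
  rw [bubble, pval_prod]
  exact Finset.prod_ne_zero_iff.2 hy1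

/-- A weak function is constant on an element and its faces, with the same constant. -/
def IsConstOn {k q : ℕ} (v : M.Vh k q) (i : ι) : Prop :=
  ∃ c : ℝ, (v.1 i : MvPolynomial (Fin d) ℝ) = MvPolynomial.C c ∧
    ∀ σ ∈ M.faces i, ∀ x : M.face σ, (v.2 σ : M.face σ → ℝ) x = c

/-- If no hyperplane contains two faces, the degree `2N + k - 1` suffices. -/
theorem isConstOn_of_distinct {k q r : ℕ} (hqk : q ≤ k) {i : ι}
    (hi : M.FacesInDistinctHyperplanes i) (hr : 2 * (M.faces i).card + k - 1 ≤ r) {v : M.Vh k q}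
    (hv : ∀ φ : PolyField d r, M.weakFunctional v i φ = 0) : M.IsConstOn v i := by
  obtain ⟨c, hc⟩ := M.exists_eq_C hr hv
  obtain ⟨b, hb⟩ := M.exists_face_repr v
  refine ⟨c, hc, fun σ hσ x => ?_⟩
  rw [(hb σ).2 x]
  set p := b σ - MvPolynomial.C c with hp
  set B := M.bubble i (M.otherFaces i σ) with hB
  have hpd : p.totalDegree ≤ q := by
    refine (MvPolynomial.totalDegree_sub_C_le _ _).trans (hb σ).1
  have hBd : (B ^ 2).totalDegree ≤ 2 * (M.otherFaces i σ).card :=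
    (MvPolynomial.totalDegree_pow _ _).trans (by gcongr; exact M.totalDegree_bubble _ _)
  -- The bubble omits at least `σ`, so the degree is at most `2(N - 1) + q`, which is within `2N + k
  -- - 1` because `q ≤ k`.
  have hg : p * B ^ 2 ∈ MvPolynomial.restrictTotalDegree (Fin d) ℝ r := by
    rw [MvPolynomial.mem_restrictTotalDegree]
    have h1 := MvPolynomial.totalDegree_mul p (B ^ 2)
    have h2 := M.card_otherFaces_lt hσ
    omega
  -- Every face other than `σ` lies in another hyperplane, so `B` vanishes on it and only `∫_σ (p
  -- B)²` remains.
  have h0 := hv fun j => M.normal i σ j • ⟨p * B ^ 2, hg⟩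
  rw [M.weakFunctional_normal hc (fun τ => (hb τ).2) hσ _ fun τ hτ hne x hx =>
    M.vanish_of_bubble_sq_dvd (M.otherFaces_subset i σ) (dvd_mul_left _ _)
      (M.mem_otherFaces.2 ⟨hτ, hne⟩) hx, Finset.sum_eq_single σ, real_inner_self_eq_norm_sq,
    M.norm_normal i σ (M.mem_faces.1 hσ), one_pow, one_mul] at h0
  · have h1 : ∫ x in M.face σ, pval (p * B) x * pval (p * B) x ∂μHE[d - 1] = 0 := by
      rw [← h0]
      refine integral_congr_ae (Eventually.of_forall fun x => ?_)
      simp only [pval_mul, pow_two]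
      ring
    rw [integral_eq_zero_iff_of_nonneg (fun x => mul_self_nonneg _)] at h1
    · have := M.eq_of_ae_mul_bubble hσ (h1.mono fun x hx => mul_self_eq_zero.1 hx) x.2
      rwa [hp, pval_sub, pval_C, sub_eq_zero] at this
    · simp only [← pval_mul]
      exact M.integrableOn_face σ _
  · intro τ hτ hne
    rw [setIntegral_eq_zero_of_forall_eq_zero, mul_zero]
    intro x hx
    exact (M.vanish_of_bubble_sq_dvd (M.otherFaces_subset i σ)
      ((dvd_mul_left _ _).mul_left _) (M.mem_otherFaces.2 ⟨hτ, hi τ hτ σ hσ hne⟩) hx).1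
  · exact fun h => absurd hσ h

/-- A weak function whose weak functional vanishes on all polynomial fields is constant on the
element and its faces. -/
theorem isConstOn_of_forall {k q : ℕ} {i : ι} {v : M.Vh k q}
    (hv : ∀ (r : ℕ) (φ : PolyField d r), M.weakFunctional v i φ = 0) : M.IsConstOn v i := by
  obtain ⟨c, hc⟩ := M.exists_eq_C le_rfl (hv _)
  obtain ⟨b, hb⟩ := M.exists_face_repr v
  refine ⟨c, hc, fun σ hσ x => ?_⟩
  rw [(hb σ).2 x]
  set B := M.bubble i (M.otherFaces i σ) with hB
  set μ := (μHE[d - 1] : Measure (E d)).restrict (frontier (M.cell i)) with hμ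
  have hK : IsCompact (frontier (M.cell i)) :=
    (M.cell_polytope i).isCompact.of_isClosed_subset isClosed_frontier (M.frontier_subset_cell i)
  -- A polynomial factor cannot remove the faces coplanar with `σ` without vanishing on `σ` too.
  -- Their signed contributions are therefore collected in `w`, which is shown to be orthogonal to
  -- all polynomials on the frontier.
  let w : E d → ℝ := fun x => ∑ τ ∈ M.faces i, ⟪M.normal i σ, M.normal i τ⟫ *
    (M.face τ).indicator (pval ((b τ - MvPolynomial.C c) * B ^ 2)) x
  have hint : ∀ τ ∈ M.faces i, ∀ p : MvPolynomial (Fin d) ℝ,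
      Integrable ((M.face τ).indicator (pval p)) μ := by
    intro τ hτ p
    rw [integrable_indicator_iff (M.isClosed_face τ).measurableSet, hμ, IntegrableOn,
      Measure.restrict_restrict (M.isClosed_face τ).measurableSet,
      inter_eq_self_of_subset_left (M.mem_faces.1 hτ)]
    exact M.integrableOn_face τ p
  have hw : Integrable w μ :=
    integrable_finsetSum _ fun τ hτ => (hint τ hτ _).const_mul _
  have hw0 : ∀ᵐ x ∂μ, w x = 0 := by
    refine ae_eq_zero_of_integral_mul_pval hK (ae_restrict_mem hK.measurableSet) hw fun p => ?_
    have hg : p * B ^ 2 ∈ MvPolynomial.restrictTotalDegree (Fin d) ℝ (p * B ^ 2).totalDegree := by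
      rw [MvPolynomial.mem_restrictTotalDegree]
    have h0 := hv _ fun j => M.normal i σ j • ⟨p * B ^ 2, hg⟩
    rw [M.weakFunctional_normal hc (fun τ => (hb τ).2) hσ _ fun τ hτ hne x hx =>
      M.vanish_of_bubble_sq_dvd (M.otherFaces_subset i σ) (dvd_mul_left _ _)
        (M.mem_otherFaces.2 ⟨hτ, hne⟩) hx] at h0
    have h1 : ∀ x, pval p x * w x = ∑ τ ∈ M.faces i, ⟪M.normal i σ, M.normal i τ⟫ *
        (M.face τ).indicator (pval ((b τ - MvPolynomial.C c) * (p * B ^ 2))) x := by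
      intro x
      simp only [w, Finset.mul_sum]
      refine Finset.sum_congr rfl fun τ _ => ?_
      by_cases hx : x ∈ M.face τ
      · simp only [indicator_of_mem hx, pval_mul]
        ring
      · simp [indicator_of_notMem hx]
    simp only [h1]
    rw [integral_finsetSum _ fun τ hτ => (hint τ hτ _).const_mul _, ← h0]
    refine Finset.sum_congr rfl fun τ hτ => ?_
    rw [integral_const_mul, integral_indicator (M.isClosed_face τ).measurableSet, hμ,
      Measure.restrict_restrict (M.isClosed_face τ).measurableSet,
      inter_eq_self_of_subset_left (M.mem_faces.1 hτ)]
  have hae : ∀ᵐ x ∂(μHE[d - 1] : Measure (E d)).restrict (M.face σ), w x = 0 :=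
    ae_restrict_of_ae_restrict_of_subset (M.mem_faces.1 hσ) hw0
  have h2 : ∀ᵐ x ∂(μHE[d - 1] : Measure (E d)).restrict (M.face σ),
      pval ((b σ - MvPolynomial.C c) * B) x = 0 := by
    -- Almost every point of `σ` lies on no other face, so the sum `w` reduces there to its `σ`
    -- term.
    filter_upwards [hae, ae_restrict_of_ae M.ae_notMem_other_face,
      ae_restrict_mem (M.isClosed_face σ).measurableSet] with y hy hy1 hyσ
    simp only [w] at hy
    rw [Finset.sum_eq_single σ, indicator_of_mem hyσ, real_inner_self_eq_norm_sq,
      M.norm_normal i σ (M.mem_faces.1 hσ), one_pow, one_mul] at hy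
    · simp only [pval_mul, pow_two] at hy ⊢
      rw [← mul_assoc] at hy
      rcases mul_eq_zero.1 hy with h | h
      · exact h
      · rw [h, mul_zero]
    · intro τ _ hne
      rw [indicator_of_notMem (hy1 σ τ hne.symm hyσ), mul_zero]
    · exact fun h => absurd hσ h
  have := M.eq_of_ae_mul_bubble hσ h2 x.2
  rwa [pval_sub, pval_C, sub_eq_zero] at this

end PolytopalMesh

/-! ### From the elements to the domain -/

theorem euclideanHausdorffMeasure_image_eq_zero {X Y : Type*} [EMetricSpace X]
    [EMetricSpace Y] [MeasurableSpace X] [BorelSpace X] [MeasurableSpace Y] [BorelSpace Y]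
    {f : X → Y} {K : NNReal} (hf : LipschitzWith K f) {m : ℕ} {s : Set X} (hs : μHE[m] s = 0) :
    μHE[m] (f '' s) = 0 := by
  have h0 : Measure.hausdorffMeasure (m : ℝ) s = 0 := by
    rw [Measure.euclideanHausdorffMeasure_def, Measure.smul_apply, smul_eq_zero] at hs
    exact hs.resolve_left (Measure.addHaarScalarFactor_volume_hausdorffMeasure_ne_zero m)
  have h1 := hf.hausdorffMeasure_image_le (Nat.cast_nonneg m) s
  rw [h0, mul_zero, nonpos_iff_eq_zero] at h1
  rw [Measure.euclideanHausdorffMeasure_def, Measure.smul_apply, h1, smul_zero]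

/-- Through every nonempty open set there is a line in a given direction that avoids a given set of
vanishing `(d-1)`-dimensional measure. -/
theorem exists_line_avoiding {d : ℕ} {Z : Set (E d)} (hZ : μHE[d - 1] Z = 0) {n : E d}
    (hn : ‖n‖ = 1) {U : Set (E d)} (hU : IsOpen U) (hne : U.Nonempty) :
    ∃ x ∈ U, ∀ t : ℝ, t • n + x ∉ Z := by
  obtain ⟨x₀, hx₀⟩ := hne
  -- The lines that meet `Z` are those over its projection, which is null since `π` is Lipschitz.
  -- The lines through `U` contain a nonempty open family, so one of them avoids `Z`.
  set π := (ℝ ∙ n)ᗮ.orthogonalProjectionOnto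
  have hlip : LipschitzWith ‖π‖₊ π := π.lipschitz
  have hnull := euclideanHausdorffMeasure_image_eq_zero hlip hZ
  rw [volume_orthogonal_unit hn] at hnull
  have hnull' : volume ((fun w => w + π x₀) ⁻¹' (π '' Z)) = 0 := by
    rw [measure_preimage_add_right, hnull]
  have hopen : IsOpen ((fun w : (ℝ ∙ n)ᗮ => (w : E d) + x₀) ⁻¹' U) :=
    hU.preimage (isometry_add_orthogonal n x₀).continuous
  have hpos := hopen.measure_pos volume ⟨0, by simpa using hx₀⟩
  obtain ⟨w, hwU, hw⟩ : (((fun w : (ℝ ∙ n)ᗮ => (w : E d) + x₀) ⁻¹' U) \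
      ((fun w => w + π x₀) ⁻¹' (π '' Z))).Nonempty := by
    refine nonempty_of_measure_ne_zero (μ := volume) ?_
    rw [measure_sdiff_null hnull']
    exact hpos.ne'
  refine ⟨w + x₀, hwU, fun t ht => hw ⟨_, ht, ?_⟩⟩
  have h1 : π n = 0 := Submodule.orthogonalProjectionOnto_orthogonalComplement_singleton_eq_zero n
  have h2 : π (w : E d) = w := Submodule.orthogonalProjectionOnto_mem_subspace_eq_self w
  simp [h1, h2]

/-- A ray into a half-space starts in the interior of a set that is locally the half-space. -/
theorem eventually_mem_interior_of_halfspace {d : ℕ} {T : Set (E d)} {n x v : E d}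
    (h : ∀ᶠ y in 𝓝 x, y ∈ T ↔ ⟪n, y - x⟫ ≤ 0) (hv : ⟪n, v⟫ < 0) :
    ∀ᶠ t in 𝓝[>] (0 : ℝ), t • v + x ∈ interior T := by
  have h1 := (tendsto_line v x).eventually h.eventually_nhds
  filter_upwards [h1.filter_mono nhdsWithin_le_nhds, self_mem_nhdsWithin] with t ht ht0
  have ht1 : 0 < t := ht0
  rw [mem_interior_iff_mem_nhds]
  have hc : Continuous fun z : E d => ⟪n, z - x⟫ := by fun_prop
  have hlt : ⟪n, t • v + x - x⟫ < 0 := by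
    rw [add_sub_cancel_right, inner_smul_right]
    exact mul_neg_of_pos_of_neg ht1 hv
  filter_upwards [ht, hc.continuousAt.eventually_lt_const hlt] with z hz hz1
  exact hz.2 hz1.le

/-- Two sets with disjoint interiors that are locally half-spaces have opposite normals. -/
theorem normal_eq_neg_of_disjoint {d : ℕ} {T T' : Set (E d)} {n n' x : E d} (hn : ‖n‖ = 1)
    (hn' : ‖n'‖ = 1) (h : ∀ᶠ y in 𝓝 x, y ∈ T ↔ ⟪n, y - x⟫ ≤ 0)
    (h' : ∀ᶠ y in 𝓝 x, y ∈ T' ↔ ⟪n', y - x⟫ ≤ 0) (hd : Disjoint (interior T) (interior T')) :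
    n' = -n := by
  by_contra hne
  have h0 : ⟪n, n'⟫ ≠ -1 := fun h1 => by
    refine hne ?_
    rw [(inner_eq_neg_one_iff_of_norm_eq_one hn hn').1 h1, neg_neg]
  have h1 : -1 < ⟪n, n'⟫ := by
    refine lt_of_le_of_ne ?_ h0.symm
    have := (abs_le.1 (abs_real_inner_le_norm n n')).1
    rwa [hn, hn', one_mul] at this
  -- Unless the normals are opposite, `-(n + n')` points strictly into both half-spaces, and a short
  -- ray in that direction lies in both interiors.
  have h2 : ⟪n, -(n + n')⟫ < 0 := by
    rw [inner_neg_right, inner_add_right, real_inner_self_eq_norm_sq, hn]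
    linarith
  have h3 : ⟪n', -(n + n')⟫ < 0 := by
    rw [inner_neg_right, inner_add_right, real_inner_self_eq_norm_sq, hn', real_inner_comm]
    linarith
  obtain ⟨t, ht, ht'⟩ := ((eventually_mem_interior_of_halfspace h h2).and
    (eventually_mem_interior_of_halfspace h' h3)).exists
  exact Set.disjoint_left.1 hd ht ht'

theorem IsPolytope.subset_of_ae {d m : ℕ} {S F : Set (E d)} (h : IsPolytope m S) (hF : IsClosed F)
    (hae : ∀ᵐ x ∂(μHE[m] : Measure (E d)), x ∈ S → x ∈ F) : S ⊆ F := by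
  intro x hx
  by_contra hxF
  refine h.measure_inter_ne_zero hx (hF.isOpen_compl.mem_nhds hxF) ?_
  refine measure_mono_null (fun y hy => ?_) (ae_iff.1 hae)
  exact fun h' => hy.2 (h' hy.1)

namespace PolytopalMesh

variable {d : ℕ} {Ω : Set (E d)} {ι κ : Type*} (M : PolytopalMesh d Ω ι κ)

/-- The elements are finitely many closed sets, so those not containing `x` stay away from a
neighbourhood of it. -/
theorem eventually_mem_cell_imp [Fintype ι] (x : E d) :
    ∀ᶠ y in 𝓝 x, ∀ i, y ∈ M.cell i → x ∈ M.cell i := by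
  rw [eventually_all]
  intro i
  by_cases hx : x ∈ M.cell i
  · simp [hx]
  · filter_upwards [(M.isClosed_cell i).isOpen_compl.mem_nhds hx] with y hy h
    exact absurd h hy

variable [Fintype κ]

theorem ae_halfspace [Fintype ι] : ∀ᵐ x ∂(μHE[d - 1] : Measure (E d)), ∀ i, ∀ σ ∈ M.faces i,
    x ∈ M.face σ → ∀ᶠ y in 𝓝 x, y ∈ M.cell i ↔ ⟪M.normal i σ, y - x⟫ ≤ 0 := by
  rw [eventually_all]
  intro i
  rw [eventually_all_finset]
  intro σ hσ
  exact (ae_restrict_iff' (M.isClosed_face σ).measurableSet).1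
    (M.ae_normal_outward (M.mem_faces.1 hσ))

theorem face_subset_cell {i : ι} {σ : κ} (hσ : σ ∈ M.faces i) : M.face σ ⊆ M.cell i :=
  (M.mem_faces.1 hσ).trans (M.frontier_subset_cell i)

/-- A face of only one element lies on the boundary of the domain. -/
theorem face_subset_frontier [Fintype ι] (hΩ : IsOpen Ω) {i : ι} {σ : κ} (hσ : σ ∈ M.faces i)
    (h : ∀ j, σ ∈ M.faces j → j = i) : M.face σ ⊆ frontier Ω := by
  refine (M.face_polytope σ).subset_of_ae isClosed_frontier ?_
  filter_upwards [M.ae_halfspace, M.ae_notMem_other_face] with x hx1 hx2 hxσ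
  have hn := M.norm_normal i σ (M.mem_faces.1 hσ)
  have hloc := hx1 i σ hσ hxσ
  -- If `x` were interior to another element, that element would overlap the `i`-th one. If it were
  -- on its frontier, then `σ`, the only face through `x`, would be a face of both.
  have hcell : ∀ j, x ∈ M.cell j → j = i := by
    intro j hj
    by_cases hint : x ∈ interior (M.cell j)
    · by_contra hne
      have h1 := eventually_mem_interior_of_halfspace hloc
        (v := -M.normal i σ) (by simp [hn])
      have h2 := (tendsto_line (-M.normal i σ) x).eventually (isOpen_interior.mem_nhds hint)
      obtain ⟨t, ht1, ht2⟩ := (h1.and (h2.filter_mono nhdsWithin_le_nhds)).exists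
      exact Set.disjoint_left.1 (M.cell_disjoint j i hne) ht2 ht1
    · obtain ⟨τ, hτ, hxτ⟩ := M.exists_mem_face (i := j) ⟨subset_closure hj, hint⟩
      by_cases he : τ = σ
      · exact h j (he ▸ hτ)
      · exact absurd hxσ (hx2 τ σ he hxτ)
  have hxcl : x ∈ closure Ω := by
    rw [← M.iUnion_cell]
    exact mem_iUnion.2 ⟨i, M.face_subset_cell hσ hxσ⟩
  refine ⟨hxcl, ?_⟩
  rw [hΩ.interior_eq]
  intro hxΩ
  -- If `x` were in `Ω`, the `i`-th element alone would cover a neighbourhood of `x`, although it is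
  -- locally a half-space.
  have hev : ∀ᶠ y in 𝓝 x, ⟪M.normal i σ, y - x⟫ ≤ 0 := by
    filter_upwards [hloc, M.eventually_mem_cell_imp x, hΩ.mem_nhds hxΩ] with y hy1 hy2 hy3
    have : y ∈ closure Ω := subset_closure hy3
    rw [← M.iUnion_cell] at this
    obtain ⟨j, hj⟩ := mem_iUnion.1 this
    refine hy1.1 ?_
    rw [← hcell j (hy2 j hj)]
    exact hj
  have h1 := (tendsto_line (M.normal i σ) x).eventually hev
  obtain ⟨t, ht, ht0⟩ := ((h1.filter_mono nhdsWithin_le_nhds).and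
    (self_mem_nhdsWithin (s := Ioi (0 : ℝ)))).exists
  have ht1 : 0 < t := ht0
  rw [add_sub_cancel_right, inner_smul_right, real_inner_self_eq_norm_sq, hn] at ht
  linarith

/-- A nonempty open set inside the union of the elements meets the interior of one of them. -/
theorem exists_mem_interior_cell [Fintype ι] {U : Set (E d)} (hU : IsOpen U) (hne : U.Nonempty)
    (hsub : U ⊆ ⋃ i, M.cell i) : ∃ x ∈ U, ∃ i, x ∈ interior (M.cell i) := by
  have hnull : volume (⋃ i, frontier (M.cell i)) = 0 :=
    measure_iUnion_null fun i => M.volume_frontier i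
  obtain ⟨x, hxU, hx⟩ : (U \ ⋃ i, frontier (M.cell i)).Nonempty := by
    refine nonempty_of_measure_ne_zero (μ := volume) ?_
    rw [measure_sdiff_null hnull]
    exact (hU.measure_pos volume hne).ne'
  obtain ⟨i, hi⟩ := mem_iUnion.1 (hsub hxU)
  refine ⟨x, hxU, i, ?_⟩
  by_contra hint
  exact hx (mem_iUnion.2 ⟨i, subset_closure hi, hint⟩)

/-- A weak function in `V_h^0` that is constant on each element and its faces is zero. -/
theorem eq_zero_of_isConstOn [Fintype ι] (hd : 1 ≤ d) (hΩ : IsOpen Ω)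
    (hΩb : Bornology.IsBounded Ω) {k q : ℕ} {v : M.Vh k q} (hv : v ∈ M.Vh0 k q)
    (hc : ∀ i, M.IsConstOn v i) : v = 0 := by
  choose c hc1 hc2 using hc
  suffices hzero : ∀ i, c i = 0 by
    refine Prod.ext (funext fun i => Subtype.ext ?_) (funext fun σ => Subtype.ext (funext fun x => ?_))
    · rw [hc1 i, hzero i, map_zero]
      rfl
    · obtain ⟨i, hi⟩ := M.face_subset σ
      rw [hc2 i σ (M.mem_faces.2 hi) x, hzero i]
      rfl
  -- Near points of `A₀` only elements with constant zero occur, possibly none; near points of `A₁`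
  -- the elements cover everything and have nonzero constants. These open sets are disjoint, and
  -- together they miss only a `(d-1)`-dimensional null set.
  let A₀ : Set (E d) := {x | ∀ᶠ y in 𝓝 x, ∀ i, y ∈ interior (M.cell i) → c i = 0}
  let A₁ : Set (E d) := {x | ∀ᶠ y in 𝓝 x, y ∈ ⋃ i, M.cell i ∧
    ∀ i, y ∈ interior (M.cell i) → c i ≠ 0}
  have hA₀ : IsOpen A₀ := isOpen_setOfPred_eventually_nhds
  have hA₁ : IsOpen A₁ := isOpen_setOfPred_eventually_nhds
  have hdisj : ∀ x, x ∈ A₀ → x ∈ A₁ → False := by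
    intro x h0 h1
    obtain ⟨U, hU, hUo, hxU⟩ := eventually_nhds_iff.1 ((show ∀ᶠ y in 𝓝 x, _ from h0).and h1)
    obtain ⟨y, hyU, i, hi⟩ := M.exists_mem_interior_cell hUo ⟨x, hxU⟩ fun y hy => (hU y hy).2.1
    exact (hU y hyU).2.2 i hi ((hU y hyU).1 i hi)
  have hint : ∀ i, ∀ x ∈ interior (M.cell i),
      ∀ᶠ y in 𝓝 x, y ∈ M.cell i ∧ ∀ j, y ∈ interior (M.cell j) → j = i := by
    intro i x hx
    filter_upwards [isOpen_interior.mem_nhds hx] with y hy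
    refine ⟨interior_subset hy, fun j hj => ?_⟩
    by_contra hne
    exact Set.disjoint_left.1 (M.cell_disjoint j i hne) hj hy
  have hint₁ : ∀ i, c i ≠ 0 → ∀ x ∈ interior (M.cell i), x ∈ A₁ := by
    intro i hi x hx
    filter_upwards [hint i x hx] with y hy
    exact ⟨mem_iUnion.2 ⟨i, hy.1⟩, fun j hj => hy.2 j hj ▸ hi⟩
  have hout : ∀ x, x ∉ ⋃ i, M.cell i → x ∈ A₀ := by
    intro x hx
    filter_upwards [M.eventually_mem_cell_imp x] with y hy i hi
    exact absurd (mem_iUnion.2 ⟨i, hy i (interior_subset hi)⟩) hx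
  have hZ : μHE[d - 1] (A₀ ∪ A₁)ᶜ = 0 := by
    refine (ae_iff (p := fun x => x ∈ A₀ ∪ A₁)).1 ?_
    filter_upwards [M.ae_halfspace, M.ae_notMem_other_face] with x hx1 hx2
    by_cases hx : x ∈ ⋃ i, M.cell i
    swap
    · exact Or.inl (hout x hx)
    by_cases hxi : ∃ i, x ∈ interior (M.cell i)
    · obtain ⟨i, hi⟩ := hxi
      by_cases hci : c i = 0
      · left
        filter_upwards [hint i x hi] with y hy j hj
        rw [hy.2 j hj, hci]
      · exact Or.inr (hint₁ i hci x hi)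
    push Not at hxi
    have hfr : ∀ i, x ∈ M.cell i → ∃ σ ∈ M.faces i, x ∈ M.face σ := fun i hi =>
      M.exists_mem_face ⟨subset_closure hi, hxi i⟩
    obtain ⟨i, hi⟩ := mem_iUnion.1 hx
    obtain ⟨σ, hσ, hxσ⟩ := hfr i hi
    have hface : ∀ j, x ∈ M.cell j → σ ∈ M.faces j := by
      intro j hj
      obtain ⟨τ, hτ, hxτ⟩ := hfr j hj
      by_cases he : τ = σ
      · exact he ▸ hτ
      · exact absurd hxσ (hx2 τ σ he hxτ)
    -- All elements at a generic frontier point share its unique face `σ`, and the single-valued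
    -- face value equates their constants.
    have hcj : ∀ j, x ∈ M.cell j → c j = c i := by
      intro j hj
      rw [← hc2 j σ (hface j hj) ⟨x, hxσ⟩, ← hc2 i σ hσ ⟨x, hxσ⟩]
    by_cases hci : c i = 0
    · left
      filter_upwards [M.eventually_mem_cell_imp x] with y hy j hj
      rw [hcj j (hy j (interior_subset hj)), hci]
    · right
      -- A nonzero constant excludes a boundary face, so `σ` has a second element; its normal is
      -- opposite, and the two half-spaces fill a neighbourhood.
      have hcover : ∀ᶠ y in 𝓝 x, y ∈ ⋃ i, M.cell i := by
        obtain ⟨j, hj, hji⟩ : ∃ j, σ ∈ M.faces j ∧ j ≠ i := by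
          by_contra! hcon
          have h0 := hv σ (M.face_subset_frontier hΩ hσ hcon)
          refine hci ?_
          rw [← hc2 i σ hσ ⟨x, hxσ⟩, h0]
          rfl
        have hli := hx1 i σ hσ hxσ
        have hlj := hx1 j σ hj hxσ
        have hneg := normal_eq_neg_of_disjoint (M.norm_normal i σ (M.mem_faces.1 hσ))
          (M.norm_normal j σ (M.mem_faces.1 hj)) hli hlj (M.cell_disjoint i j hji.symm)
        filter_upwards [hli, hlj] with y hyi hyj
        rw [hneg, inner_neg_left] at hyj
        rcases le_total ⟪M.normal i σ, y - x⟫ 0 with h | h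
        · exact mem_iUnion.2 ⟨i, hyi.2 h⟩
        · exact mem_iUnion.2 ⟨j, hyj.2 (by linarith)⟩
      filter_upwards [hcover, M.eventually_mem_cell_imp x] with y hy1 hy2
      exact ⟨hy1, fun j hj => by rwa [hcj j (hy2 j (interior_subset hj))]⟩
  intro i
  by_contra hi
  -- A line from an element with nonzero constant, avoiding the exceptional null set, is covered by
  -- `A₀` and `A₁`. It starts in `A₁` and reaches `A₀` outside the bounded domain, against
  -- connectedness of the line; `Ω` itself need not be connected.
  set n : E d := EuclideanSpace.single ⟨0, hd⟩ 1 with hndef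
  have hn : ‖n‖ = 1 := by simp [hndef]
  obtain ⟨x, hx, hline⟩ := exists_line_avoiding hZ hn isOpen_interior
    (M.cell_polytope i).nonempty_interior
  have hγ : Continuous fun t : ℝ => t • n + x := by fun_prop
  have hpre : IsPreconnected (range fun t : ℝ => t • n + x) := isPreconnected_range hγ
  have hbdd : Bornology.IsBounded (⋃ i, M.cell i) := by
    rw [M.iUnion_cell]
    exact hΩb.closure
  obtain ⟨R, hR⟩ := hbdd.subset_ball x
  have hfar : |R| • n + x ∉ ⋃ i, M.cell i := by
    intro hmem
    have := hR hmem
    rw [Metric.mem_ball, dist_eq_norm, add_sub_cancel_right, norm_smul, hn, mul_one,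
      Real.norm_eq_abs, abs_abs] at this
    exact absurd (le_abs_self R) (not_le.2 this)
  obtain ⟨y, -, hy0, hy1⟩ := hpre A₀ A₁ hA₀ hA₁
    (by rintro _ ⟨t, rfl⟩; exact not_not.1 (hline t))
    ⟨_, ⟨|R|, rfl⟩, hout _ hfar⟩ ⟨x, ⟨0, by simp⟩, hint₁ i hi x hx⟩
  exact hdisj y hy0 hy1

end PolytopalMesh

/-! ### Linear algebra and unique solvability -/

section FieldInner

variable {d r : ℕ} {S : Set (E d)}

theorem fieldInner_comm (φ ψ : PolyField d r) : fieldInner S φ ψ = fieldInner S ψ φ := by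
  simp only [fieldInner, mul_comm]

theorem fieldInner_add_left (hS : IsPolytope d S) (φ φ' ψ : PolyField d r) :
    fieldInner S (φ + φ') ψ = fieldInner S φ ψ + fieldInner S φ' ψ := by
  simp only [fieldInner, Pi.add_apply, Submodule.coe_add, pval_add, add_mul,
    integral_add (integrableOn_cell hS _ _) (integrableOn_cell hS _ _), Finset.sum_add_distrib]

theorem fieldInner_smul_left (c : ℝ) (φ ψ : PolyField d r) :
    fieldInner S (c • φ) ψ = c * fieldInner S φ ψ := by
  simp only [fieldInner, Pi.smul_apply, Submodule.coe_smul, pval_smul, mul_assoc,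
    integral_const_mul, Finset.mul_sum]

theorem fieldInner_add_right (hS : IsPolytope d S) (φ ψ ψ' : PolyField d r) :
    fieldInner S φ (ψ + ψ') = fieldInner S φ ψ + fieldInner S φ ψ' := by
  rw [fieldInner_comm, fieldInner_add_left hS, fieldInner_comm ψ, fieldInner_comm ψ']

theorem fieldInner_smul_right (c : ℝ) (φ ψ : PolyField d r) :
    fieldInner S φ (c • ψ) = c * fieldInner S φ ψ := by
  rw [fieldInner_comm, fieldInner_smul_left, fieldInner_comm]

theorem fieldInner_self_nonneg (φ : PolyField d r) : 0 ≤ fieldInner S φ φ :=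
  Finset.sum_nonneg fun _ _ => integral_nonneg fun _ => mul_self_nonneg _

theorem fieldInner_self_eq_zero (hS : IsPolytope d S) {φ : PolyField d r}
    (h : fieldInner S φ φ = 0) : φ = 0 := by
  have h1 := (Finset.sum_eq_zero_iff_of_nonneg (fun j _ =>
    integral_nonneg fun x => mul_self_nonneg (pval (φ j : MvPolynomial (Fin d) ℝ) x))).1 h
  exact funext fun j => Subtype.ext (eq_zero_of_integral_sq hS _ (h1 j (Finset.mem_univ j)))

theorem fieldInner_zero_left (ψ : PolyField d r) : fieldInner S 0 ψ = 0 := by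
  simp [fieldInner]

/-- A definite bilinear form on a finite-dimensional space represents every linear form. -/
theorem existsUnique_of_bilinear {V : Type*} [AddCommGroup V] [Module ℝ V] [FiniteDimensional ℝ V]
    {b : V → V → ℝ} (hal : ∀ u u' v, b (u + u') v = b u v + b u' v)
    (hsl : ∀ (c : ℝ) u v, b (c • u) v = c * b u v) (har : ∀ u v v', b u (v + v') = b u v + b u v')
    (hsr : ∀ (c : ℝ) u v, b u (c • v) = c * b u v) (hdef : ∀ u, b u u = 0 → u = 0) {F : V → ℝ}
    (hFa : ∀ u v, F (u + v) = F u + F v) (hFs : ∀ (c : ℝ) u, F (c • u) = c * F u) :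
    ∃! u, ∀ v, b u v = F v := by
  let B : V →ₗ[ℝ] V →ₗ[ℝ] ℝ := LinearMap.mk₂ ℝ b hal hsl har hsr
  have hinj : Function.Injective B := by
    rw [← LinearMap.ker_eq_bot, LinearMap.ker_eq_bot']
    exact fun u hu => hdef u (LinearMap.congr_fun hu u)
  have hsurj : Function.Surjective B :=
    (LinearMap.injective_iff_surjective_of_finrank_eq_finrank
      (Subspace.dual_finrank_eq (K := ℝ) (V := V)).symm).1 hinj
  obtain ⟨u, hu⟩ := hsurj { toFun := F, map_add' := hFa, map_smul' := hFs }
  refine ⟨u, LinearMap.congr_fun hu, fun u' hu' => hinj (LinearMap.ext fun v => ?_)⟩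
  rw [hu]
  exact hu' v

end FieldInner

instance {d : ℕ} (S : Set (E d)) (m : ℕ) : FiniteDimensional ℝ (P S m) := by
  unfold P
  infer_instance

namespace PolytopalMesh

variable {d : ℕ} {Ω : Set (E d)} {ι κ : Type*} (M : PolytopalMesh d Ω ι κ)

theorem integrable_faceTerm {k q r : ℕ} (v : M.Vh k q) (i : ι) (σ : κ) (φ : PolyField d r) :
    Integrable (fun x : M.face σ => (v.2 σ : M.face σ → ℝ) x *
      ∑ j, pval (φ j : MvPolynomial (Fin d) ℝ) (x : E d) * M.normal i σ j) μHE[d - 1] :=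
  integrable_face (M.face_polytope σ) ((continuous_of_mem_P (v.2 σ).2).mul
    (continuous_finsetSum _ fun _ _ =>
      ((continuous_pval _).comp continuous_subtype_val).mul continuous_const))

section WeakGradient

variable [Fintype κ] {k q r : ℕ}

theorem weakFunctional_add (u v : M.Vh k q) (i : ι) (φ : PolyField d r) :
    M.weakFunctional (u + v) i φ = M.weakFunctional u i φ + M.weakFunctional v i φ := by
  have hS := M.cell_polytope i
  simp only [weakFunctional, Prod.fst_add, Prod.snd_add, Pi.add_apply, Submodule.coe_add, pval_add,
    add_mul, integral_add (integrableOn_cell hS _ _) (integrableOn_cell hS _ _),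
    integral_add (M.integrable_faceTerm u i _ φ) (M.integrable_faceTerm v i _ φ),
    Finset.sum_add_distrib]
  ring

theorem weakFunctional_smul (c : ℝ) (v : M.Vh k q) (i : ι) (φ : PolyField d r) :
    M.weakFunctional (c • v) i φ = c * M.weakFunctional v i φ := by
  simp only [weakFunctional, Prod.smul_fst, Prod.smul_snd, Pi.smul_apply, Submodule.coe_smul,
    pval_smul, smul_eq_mul, mul_assoc, integral_const_mul, ← Finset.mul_sum]
  ring

theorem weakGrad_unique {v : M.Vh k q} {i : ι} {g : PolyField d r}
    (hg : ∀ φ : PolyField d r, fieldInner (M.cell i) g φ = M.weakFunctional v i φ) :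
    M.weakGrad r v i = g :=
  (M.existsUnique_weakGrad r v i).unique (M.weakGrad_spec r v i) hg

theorem weakGrad_add (u v : M.Vh k q) (i : ι) :
    M.weakGrad r (u + v) i = M.weakGrad r u i + M.weakGrad r v i :=
  M.weakGrad_unique fun φ => by
    rw [fieldInner_add_left (M.cell_polytope i), weakGrad_spec, weakGrad_spec, weakFunctional_add]

theorem weakGrad_smul (c : ℝ) (v : M.Vh k q) (i : ι) :
    M.weakGrad r (c • v) i = c • M.weakGrad r v i :=
  M.weakGrad_unique fun φ => by
    rw [fieldInner_smul_left, weakGrad_spec, weakFunctional_smul]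

/-- The weak functions whose weak gradient of degree `r` vanishes on an element. -/
def weakGradKer (k q r : ℕ) (i : ι) : Submodule ℝ (M.Vh k q) where
  carrier := {v | ∀ φ : PolyField d r, M.weakFunctional v i φ = 0}
  add_mem' := by
    intro u v hu hv φ
    rw [weakFunctional_add, hu φ, hv φ, add_zero]
  zero_mem' := by
    intro φ
    have := M.weakFunctional_smul 0 (0 : M.Vh k q) i φ
    rwa [zero_smul, zero_mul] at this
  smul_mem' := by
    intro c v hv φ
    rw [weakFunctional_smul, hv φ, mul_zero]

theorem mem_weakGradKer {i : ι} {v : M.Vh k q} : v ∈ M.weakGradKer k q r i ↔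
    ∀ φ : PolyField d r, M.weakFunctional v i φ = 0 :=
  Iff.rfl

/-- A higher degree only adds test fields. Describing the kernel by the functional instead of the
gradient makes different degrees comparable. -/
theorem weakGradKer_antitone (k q : ℕ) (i : ι) : Antitone fun r => M.weakGradKer k q r i := by
  intro r s hrs v hv φ
  have hle : ∀ j, (φ j : MvPolynomial (Fin d) ℝ) ∈
      MvPolynomial.restrictTotalDegree (Fin d) ℝ s := fun j =>
    (MvPolynomial.mem_restrictTotalDegree _ _ _).2
      (((MvPolynomial.mem_restrictTotalDegree _ _ _).1 (φ j).2).trans hrs)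
  exact hv fun j => ⟨_, hle j⟩

/-- For each element there is a degree from which on weak functions with vanishing weak gradient are
constant on the element and its faces. -/
theorem exists_degree_isConstOn [Fintype ι] (k q : ℕ) (i : ι) :
    ∃ r₀, ∀ r, r₀ ≤ r → ∀ v ∈ M.weakGradKer k q r i, M.IsConstOn v i := by
  -- The decreasing chain of kernels in the finite-dimensional `Vh` becomes stationary. A member of
  -- the stationary kernel is annihilated by test fields of every degree.
  obtain ⟨r₀, hr₀⟩ := IsArtinian.monotone_stabilizes
    (⟨fun r => OrderDual.toDual (M.weakGradKer k q r i), M.weakGradKer_antitone k q i⟩ :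
      ℕ →o (Submodule ℝ (M.Vh k q))ᵒᵈ)
  have hst : ∀ m, r₀ ≤ m → M.weakGradKer k q r₀ i = M.weakGradKer k q m i := hr₀
  refine ⟨r₀, fun r hr v hv => M.isConstOn_of_forall fun s => ?_⟩
  rw [← M.mem_weakGradKer]
  refine M.weakGradKer_antitone k q i (le_max_right r₀ s) ?_
  show v ∈ M.weakGradKer k q (max r₀ s) i
  rwa [← hst _ (le_max_left r₀ s), hst r hr]

end WeakGradient

variable [Fintype κ] {k q : ℕ}

/-- The load is controlled only on `Ω`, which contains the interior of the element but perhaps not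
all of it; the null frontier makes up the difference. -/
theorem integrableOn_load {f : E d → ℝ} (hf : MemLp f 2 (volume.restrict Ω)) (i : ι)
    (p : MvPolynomial (Fin d) ℝ) : IntegrableOn (fun x => f x * pval p x) (M.cell i) := by
  have h1 : MemLp f 2 (volume.restrict (interior (M.cell i))) :=
    hf.mono_measure (Measure.restrict_mono (M.interior_cell_subset i) le_rfl)
  have h2 : (interior (M.cell i) : Set (E d)) =ᵐ[volume] M.cell i :=
    interior_ae_eq_of_null_frontier (M.volume_frontier i)
  rw [Measure.restrict_congr_set h2] at h1
  have hfin : IsFiniteMeasure (volume.restrict (M.cell i)) :=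
    ⟨by simpa using (M.cell_polytope i).isCompact.measure_lt_top⟩
  obtain ⟨C, hC⟩ := (M.cell_polytope i).isCompact.exists_bound_of_continuousOn
    (continuous_pval p).continuousOn
  exact (h1.integrable one_le_two).mul_bdd (continuous_pval p).aestronglyMeasurable
    (ae_restrict_of_forall_mem (M.isClosed_cell i).measurableSet hC)

/-- The scheme is uniquely solvable if weak functions with vanishing weak gradient are constant on
the elements and their faces. -/
theorem existsUnique_isWGSolution [Fintype ι] (hd : 1 ≤ d) (hΩ : IsOpen Ω) (hΩb : Bornology.IsBounded Ω)
    {r : ι → ℕ} (hr : ∀ i, ∀ v ∈ M.weakGradKer k q (r i) i, M.IsConstOn v i) {f : E d → ℝ}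
    (hf : MemLp f 2 (volume.restrict Ω)) : ∃! u : M.Vh k q, M.IsWGSolution r f u := by
  obtain ⟨u, hu, huniq⟩ := existsUnique_of_bilinear (V := M.Vh0 k q)
    (b := fun u v =>
      ∑ i, fieldInner (M.cell i) (M.weakGrad (r i) u.1 i) (M.weakGrad (r i) v.1 i))
    (F := fun v => ∑ i, ∫ x in M.cell i, f x * pval (v.1.1 i : MvPolynomial (Fin d) ℝ) x)
    (by
      intro u u' v
      simp only [Submodule.coe_add, weakGrad_add, fieldInner_add_left (M.cell_polytope _),
        Finset.sum_add_distrib])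
    (by
      intro c u v
      simp only [Submodule.coe_smul, weakGrad_smul, fieldInner_smul_left, Finset.mul_sum])
    (by
      intro u v v'
      simp only [Submodule.coe_add, weakGrad_add, fieldInner_add_right (M.cell_polytope _),
        Finset.sum_add_distrib])
    (by
      intro c u v
      simp only [Submodule.coe_smul, weakGrad_smul, fieldInner_smul_right, Finset.mul_sum])
    (by
      intro u h0
      -- Definiteness: zero energy forces each weak gradient, and hence each weak functional, to
      -- vanish, so `u` is constant on every element and its faces.
      rw [Finset.sum_eq_zero_iff_of_nonneg fun i _ => fieldInner_self_nonneg _] at h0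
      refine Subtype.ext (M.eq_zero_of_isConstOn hd hΩ hΩb u.2 fun i => hr i _ fun φ => ?_)
      rw [← M.weakGrad_spec, fieldInner_self_eq_zero (M.cell_polytope i)
        (h0 i (Finset.mem_univ i)), fieldInner_zero_left])
    (by
      intro u v
      simp only [Submodule.coe_add, Prod.fst_add, Pi.add_apply, pval_add, mul_add,
        integral_add (M.integrableOn_load hf _ _) (M.integrableOn_load hf _ _),
        Finset.sum_add_distrib])
    (by
      intro c v
      simp only [Submodule.coe_smul, Prod.smul_fst, Pi.smul_apply, pval_smul, mul_left_comm _ c,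
        integral_const_mul, Finset.mul_sum])
  refine ⟨u, ⟨u.2, fun v hv => hu ⟨v, hv⟩⟩, fun u' hu' => ?_⟩
  exact congrArg Subtype.val (huniq ⟨u', hu'.1⟩ fun v => hu'.2 v v.2)

end PolytopalMesh

end WG

theorem mainTheorem4 {d : ℕ} (hd : 1 ≤ d) {Ω : Set (WG.E d)} (hΩ : IsOpen Ω)
    (hΩb : Bornology.IsBounded Ω) {ι κ : Type*} [Fintype ι] [Fintype κ]
    (M : WG.PolytopalMesh d Ω ι κ) (k q : ℕ) (hqk : q ≤ k) :
    ∃ r₀ : ι → ℕ,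
      (∀ i, M.FacesInDistinctHyperplanes i → r₀ i = 2 * (M.faces i).card + k - 1) ∧
      ∀ r : ι → ℕ, (∀ i, r₀ i ≤ r i) →
        ∀ f : WG.E d → ℝ, MemLp f 2 (volume.restrict Ω) →
          ∃! u : M.Vh k q, M.IsWGSolution r f u := by
  classical
  choose r₁ hr₁ using M.exists_degree_isConstOn k q
  refine ⟨fun i => if M.FacesInDistinctHyperplanes i then 2 * (M.faces i).card + k - 1 else r₁ i,
    fun i hi => if_pos hi, fun r hr f hf =>
      M.existsUnique_isWGSolution hd hΩ hΩb (fun i v hv => ?_) hf⟩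
  have hri : (if M.FacesInDistinctHyperplanes i then 2 * (M.faces i).card + k - 1 else r₁ i) ≤ r i :=
    hr i
  split_ifs at hri with hi
  · exact M.isConstOn_of_distinct hqk hi hri hv
  · exact hr₁ i (r i) hri v hv
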